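/- Let $\varepsilon_i$, $i\in\mathbb Z$, be independent and identically distributed real random variables on a probability space with probability $P$, let $\theta_k$, $k\in\mathbb Z$, be real constants of which finitely many, and at least one, are nonzero, and let $X_i=\sum_k\theta_k\varepsilon_{i+k}$ for $i\in\mathbb Z$. Suppose that $P(X_0>x)>0$ for every real $x$, and that exceedances of high levels do not cluster, that is, for each integer $i_0\ge 1$, $$P\bigl(X_i>x\text{ for some } i \text{ with } 1\le|i|\le i_0 \,\big|\, X_0>x\bigr)\to 0\quad\text{as } x\to\infty .$$ Let $\beta>0$. (i) Let the thresholds $t=t(\nu)$, $\nu=1,2,\dots$, satisfy $P(X_0>t)=\beta/\nu+o(1/\nu)$ as $\nu\to\infty$, and let $1\le I_1<I_2<\cdots$ be the indices $i\ge 1$ for which $X_i>t$. Then, for each $C>0$, the point process with points $I_1/\nu, I_2/\nu,\dots$, restricted to $[0,C]$, converges weakly as $\nu\to\infty$ (as a random element of the space of finite measures on $[0,C]$ with the weak topology) to a homogeneous Poisson process on $[0,C]$ with intensity $\beta$. Moreover $N=\sum_{i=1}^{\nu}I(X_i>t)$ converges in distribution to a Poisson random variable with mean $\beta$, and for each integer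 $k\ge 1$ $$P(N\ge k)\to\sum_{j=k}^{\infty}\frac{\beta^j}{j!}e^{-\beta}.$$ (ii) Let the thresholds $t_1>t_2>\cdots$, depending on $\nu$, satisfy, for each $i\ge 1$, $P(X_0>t_i)=i\beta/\nu+o(1/\nu)$ as $\nu\to\infty$. Put $t_0=\infty$, let $N_i$ be the number of indices $j\in\{1,\dots,\nu\}$ with $t_i<X_j\le t_{i-1}$, and let $N^{(i)}=\sum_{j=1}^{\nu}I(X_j>t_i)$. Then, for each $k\ge 1$, $(N_1,\dots,N_k)$ converges in distribution to $(Q_1,\dots,Q_k)$, where $Q_1,\dots,Q_k$ are independent Poisson random variables with mean $\beta$, and $$P\bigl(N^{(i)}\ge i\text{ for } 1\le i\le k\bigr)\to P\bigl(Q_1+\cdots+Q_i\ge i\text{ for } 1\le i\le k\bigr).$$ -/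

import Mathlib

open MeasureTheory ProbabilityTheory Filter Topology Asymptotics
open scoped NNReal ENNReal BoundedContinuousFunction Nat

noncomputable section

/-- The finite-order moving average `X_i = ∑_k θ_k ε_{i+k}`; the finitely supported weights `θ`
are a finitely supported function on `ℤ`. -/
def movingAverage {Ω : Type*} (θ : ℤ →₀ ℝ) (ε : ℤ → Ω → ℝ) (i : ℤ) (ω : Ω) : ℝ :=
  ∑ k ∈ θ.support, θ k * ε (i + k) ω

/-- Absence of (asymptotic) clustering of high-level exceedances: for each fixed `i₀ ≥ 1`,
`P(X_i > x for some i with 1 ≤ |i| ≤ i₀ | X_0 > x) → 0` as `x → ∞`. -/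
def NoClustering {Ω : Type*} [MeasurableSpace Ω] (P : Measure Ω) (X : ℤ → Ω → ℝ) : Prop :=
  ∀ i₀ : ℤ, 1 ≤ i₀ →
    Tendsto (fun x : ℝ => cond P {ω | x < X 0 ω} {ω | ∃ i : ℤ, 1 ≤ |i| ∧ |i| ≤ i₀ ∧ x < X i ω})
      atTop (𝓝 0)

/-- The level `t = t(ν)` is calibrated to the mean `b`: `P(X_0 > t) = b / ν + o(1 / ν)` as
`ν → ∞`. -/
def IsCalibrated {Ω : Type*} [MeasurableSpace Ω] (P : Measure Ω) (X : ℤ → Ω → ℝ) (b : ℝ)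
    (t : ℕ → ℝ) : Prop :=
  (fun ν : ℕ => P.real {ω | t ν < X 0 ω} - b / (ν : ℝ)) =o[atTop] (fun ν : ℕ => 1 / (ν : ℝ))

open Classical in
/-- `∑_{i=1}^ν I(X_i > t)`, the number of exceedances of the level `t` (rejected hypotheses). -/
def exceedanceCount {Ω : Type*} (X : ℤ → Ω → ℝ) (ν : ℕ) (t : ℝ) (ω : Ω) : ℕ :=
  ((Finset.Icc 1 ν).filter (fun i : ℕ => t < X (i : ℤ) ω)).card

open Classical in
/-- For `i ≥ 1`, the number of indices `1 ≤ j ≤ ν` with `X_j ∈ (t_i, t_{i-1}]`, where `t_0 = ∞`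
(so for `i = 1` there is no upper constraint, and the value `t 0` is not used). -/
def bandCount {Ω : Type*} (X : ℤ → Ω → ℝ) (ν : ℕ) (t : ℕ → ℝ) (i : ℕ) (ω : Ω) : ℕ :=
  ((Finset.Icc 1 ν).filter
    (fun j : ℕ => t i < X (j : ℤ) ω ∧ (i = 1 ∨ X (j : ℤ) ω ≤ t (i - 1)))).card

/-- The unit point mass at `x`, as a finite measure. -/
def pointMass {S : Type*} [MeasurableSpace S] (x : S) : FiniteMeasure S :=
  (diracProba x).toFiniteMeasure

open Classical in
/-- The point process on `[0, C]` of the rescaled exceedance indices: with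
`1 ≤ I_1 < I_2 < ⋯` the indices `i` such that `X_i > t`, it is the counting measure of those
points `I_j / ν` that lie in `[0, C]` (equivalently, for `ν ≥ 1`, those with `I_j ≤ ⌊C ν⌋`). -/
def exceedanceProcess {Ω : Type*} (X : ℤ → Ω → ℝ) (C : ℝ) (ν : ℕ) (t : ℝ) (ω : Ω) :
    FiniteMeasure (Set.Icc (0 : ℝ) C) :=
  ∑ i ∈ (Finset.Icc 1 ⌊C * (ν : ℝ)⌋₊).filter (fun i : ℕ => t < X (i : ℤ) ω),
    if h : (i : ℝ) / (ν : ℝ) ∈ Set.Icc (0 : ℝ) C then pointMass ⟨(i : ℝ) / (ν : ℝ), h⟩ else 0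

/-- `ξ` is a homogeneous Poisson process on `[0, C]` with intensity `β`: it is a random finite
measure (for the Borel sets of the weak topology), the mass of each Borel set `B` is
Poisson-distributed with mean `β · Leb(B)`, and the masses of finitely many pairwise disjoint
Borel sets are independent. -/
structure IsHomogeneousPoissonProcess {Ω : Type*} [MeasurableSpace Ω] (P : Measure Ω)
    (C : ℝ) (β : ℝ≥0) (ξ : Ω → FiniteMeasure (Set.Icc (0 : ℝ) C)) : Prop where
  measurable : Measurable[_, borel (FiniteMeasure (Set.Icc (0 : ℝ) C))] ξ
  law_count : ∀ B : Set (Set.Icc (0 : ℝ) C), MeasurableSet B →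
    P.map (fun ω => (ξ ω : Measure (Set.Icc (0 : ℝ) C)) B) =
      (poissonMeasure (β * (volume (Subtype.val '' B : Set ℝ)).toNNReal)).map
        (fun n : ℕ => (n : ℝ≥0∞))
  indep_count : ∀ (k : ℕ) (B : Fin k → Set (Set.Icc (0 : ℝ) C)),
    (∀ i, MeasurableSet (B i)) → Pairwise (fun i j => Disjoint (B i) (B j)) →
      iIndepFun (fun i ω => (ξ ω : Measure (Set.Icc (0 : ℝ) C)) (B i)) P

/-- Weak convergence of point processes (random finite measures) `ξ_ν`, defined on `(Ω, P)`, to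
`η`, defined on `(Ω', P')`: all are random elements of the space of finite measures on `S` with
the Borel sets of its weak topology, and `E F(ξ_ν) → E F(η)` for every bounded continuous
real-valued function `F` on that space. -/
structure ConvergesWeakly {Ω Ω' S : Type*} [MeasurableSpace Ω] [MeasurableSpace Ω']
    [TopologicalSpace S] [MeasurableSpace S] [OpensMeasurableSpace S]
    (P : Measure Ω) (ξ : ℕ → Ω → FiniteMeasure S)
    (P' : Measure Ω') (η : Ω' → FiniteMeasure S) : Prop where
  measurable : ∀ ν, Measurable[_, borel (FiniteMeasure S)] (ξ ν)
  measurable_limit : Measurable[_, borel (FiniteMeasure S)] η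
  tendsto : ∀ F : FiniteMeasure S →ᵇ ℝ,
    Tendsto (fun ν => ∫ ω, F (ξ ν ω) ∂P) atTop (𝓝 (∫ ω', F (η ω') ∂P'))

end

/-!
The exceedances of a high level by a finite-order moving average are rare events which depend on
one another only within a bounded range of times, and by assumption do not cluster. Everything
rests on one estimate for products of such weakly dependent factors,
`norm_integral_prod_sub_exp_le`: if each factor `Z i` has modulus at most one and equals one
outside a rare event, then adding a factor to a product multiplies the expectation by `E Z n`, up
to the probability of two nearby rare events and terms quadratic in the probability of a single
one. No blocking argument is needed, because all the quantities involved are bounded by one and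
the errors of the single steps simply add up.

Applied to the exponentials `exp (i ∑ s_j 1[X_i ∈ B_j])`, the estimate gives the joint
characteristic function of the numbers of visits to disjoint, possibly time-dependent, sets of
high levels. By Lévy's theorem these numbers converge to independent Poisson variables
(`tendstoInDistribution_visitCount`). With a single set this is the convergence of the number of
exceedances, and with the bands between consecutive levels it is the convergence of the band
counts. With sets that depend on the cell of `[0, C]` in which the rescaled time lies, it gives the
convergence of the cell counts of the exceedance process.

The limit process is realized as a Poisson number of independent uniform points
(`isHomogeneousPoissonProcess_poissonSample`). Weak convergence in the space of finite measures
follows from that of the cell counts (`convergesWeakly_of_cellCount`): a continuous functional of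
a sum of at most `K` point masses is uniformly continuous in the positions of the points, as these
range over a compact space, so the points may be rounded to representatives of small cells.
-/

/-! ### Products of `m`-dependent factors that are rarely different from one -/

/-- An integrand bounded by `c` and supported in `S` has integral at most `c · P(S)`. -/
lemma norm_integral_le_of_support {Ω : Type*} [MeasurableSpace Ω] (P : Measure Ω)
    [IsProbabilityMeasure P] {f : Ω → ℂ} {S : Set Ω} {c : ℝ}
    (hf : ∀ ω ∉ S, f ω = 0) (hc : ∀ ω ∈ S, ‖f ω‖ ≤ c) :
    ‖∫ ω, f ω ∂P‖ ≤ c * P.real S := by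
  rw [← setIntegral_eq_integral_of_forall_compl_eq_zero hf]
  exact norm_setIntegral_le_of_norm_le_const (measure_lt_top _ _) hc

lemma integrable_of_measurable_of_norm_le {Ω : Type*} [MeasurableSpace Ω] {P : Measure Ω}
    [IsProbabilityMeasure P] {f : Ω → ℂ} (hf : Measurable f) (c : ℝ) (hc : ∀ ω, ‖f ω‖ ≤ c) :
    Integrable f P :=
  Integrable.of_bound hf.aestronglyMeasurable c (ae_of_all _ hc)

/-- The telescoping estimate. If `Z i` has modulus at most one and equals one off a rare event
`A i`, and if `Z n` is independent of the factors at distance more than `m`, then `E ∏ Z i` is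
close to `exp (∑ (E Z i - 1))`. Passing from `n` to `n + 1` factors multiplies the expectation by
`E Z n`, up to a clustering term `q` (two of the events occur at distance at most `m`) and a term
of order `p ^ 2`. -/
theorem norm_integral_prod_sub_exp_le {Ω : Type*} [MeasurableSpace Ω] (P : Measure Ω)
    [IsProbabilityMeasure P] (Z : ℕ → Ω → ℂ) (A : ℕ → Set Ω) (m : ℕ) (p q : ℝ)
    (hZ : ∀ i, Measurable (Z i)) (hZ1 : ∀ i ω, ‖Z i ω‖ ≤ 1)
    (hZA : ∀ i, ∀ ω ∉ A i, Z i ω = 1) (hp : ∀ i, P.real (A i) ≤ p) (hp2 : p ≤ 1 / 2)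
    (hq : ∀ i, P.real {ω | ω ∈ A i ∧ ∃ j < i, i ≤ j + m ∧ ω ∈ A j} ≤ q)
    (hind : ∀ i, IndepFun (Z i) (fun ω => ∏ j ∈ Finset.range (i - m), Z j ω) P) (n : ℕ) :
    ‖(∫ ω, ∏ i ∈ Finset.range n, Z i ω ∂P)
        - Complex.exp (∑ i ∈ Finset.range n, ((∫ ω, Z i ω ∂P) - 1))‖
      ≤ n * (4 * q + 4 * m * p ^ 2 + 4 * p ^ 2) := by
  have hp0 : 0 ≤ p := measureReal_nonneg.trans (hp 0)
  have hprod : ∀ s : Finset ℕ, Measurable fun ω => ∏ i ∈ s, Z i ω := fun s =>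
    Finset.measurable_fun_prod s fun i _ => hZ i
  have hprod1 : ∀ (s : Finset ℕ) ω, ‖∏ i ∈ s, Z i ω‖ ≤ 1 := fun s ω => by
    rw [norm_prod]
    exact Finset.prod_le_one (fun i _ => norm_nonneg _) fun i _ => hZ1 i ω
  have hint : ∀ s : Finset ℕ, Integrable (fun ω => ∏ i ∈ s, Z i ω) P := fun s =>
    integrable_of_measurable_of_norm_le (hprod s) 1 (hprod1 s)
  have hZint : ∀ i, Integrable (Z i) P := fun i =>
    integrable_of_measurable_of_norm_le (hZ i) 1 (hZ1 i)
  have hz1 : ∀ i, ‖∫ ω, Z i ω ∂P‖ ≤ 1 := fun i => by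
    simpa using norm_integral_le_of_norm_le_const (μ := P) (ae_of_all _ (hZ1 i))
  have hzsub : ∀ i, ∫ ω, (Z i ω - 1) ∂P = (∫ ω, Z i ω ∂P) - 1 := fun i => by
    rw [integral_sub (hZint i) (integrable_const _)]; simp
  have hsub2 : ∀ i ω, ‖Z i ω - 1‖ ≤ 2 := fun i ω => by
    calc ‖Z i ω - 1‖ ≤ ‖Z i ω‖ + ‖(1 : ℂ)‖ := norm_sub_le _ _
      _ ≤ 2 := by rw [norm_one]; linarith [hZ1 i ω]
  have hz2 : ∀ i, ‖(∫ ω, Z i ω ∂P) - 1‖ ≤ 2 * p := fun i => by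
    rw [← hzsub]
    refine (norm_integral_le_of_support P (S := A i) (c := 2) (fun ω h => by simp [hZA i ω h])
      fun ω _ => hsub2 i ω).trans ?_
    linarith [hp i]
  have hre : ∀ s : Finset ℕ, ‖Complex.exp (∑ i ∈ s, ((∫ ω, Z i ω ∂P) - 1))‖ ≤ 1 := fun s => by
    rw [Complex.norm_exp, Real.exp_le_one_iff, Complex.re_sum]
    refine Finset.sum_nonpos fun i _ => ?_
    have := (Complex.re_le_norm _).trans (hz1 i)
    simp only [Complex.sub_re, Complex.one_re]
    linarith
  induction n with
  | zero => simp
  | succ n ih =>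
    set W : Ω → ℂ := fun ω => ∏ i ∈ Finset.range n, Z i ω with hW
    set V : Ω → ℂ := fun ω => ∏ i ∈ Finset.range (n - m), Z i ω with hV
    set z : ℂ := ∫ ω, Z n ω ∂P with hz
    set e : ℂ := Complex.exp (∑ i ∈ Finset.range n, ((∫ ω, Z i ω ∂P) - 1)) with he
    have hWV : ∀ ω, W ω = V ω * ∏ i ∈ Finset.Ico (n - m) n, Z i ω := fun ω =>
      (Finset.prod_range_mul_prod_Ico (fun i => Z i ω) (Nat.sub_le n m)).symm
    have hWVeq : ∀ ω, (∀ j ∈ Finset.Ico (n - m) n, ω ∉ A j) → W ω = V ω := fun ω h => by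
      rw [hWV, Finset.prod_eq_one fun j hj => hZA j ω (h j hj), mul_one]
    have hWVn : ∀ ω, ‖W ω - V ω‖ ≤ 2 := fun ω => by
      linarith [norm_sub_le (W ω) (V ω), hprod1 (Finset.range n) ω,
        hprod1 (Finset.range (n - m)) ω]
    have hVint : Integrable V P := hint _
    have hWint : Integrable W P := hint _
    have hmulint : ∀ U : Ω → ℂ, Measurable U → (∀ ω, ‖U ω‖ ≤ 2) →
        Integrable (fun ω => (Z n ω - 1) * U ω) P := fun U hU h2 =>
      integrable_of_measurable_of_norm_le (((hZ n).sub_const 1).mul hU) (2 * 2) fun ω => by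
        rw [norm_mul]; exact mul_le_mul (hsub2 n ω) (h2 ω) (norm_nonneg _) (by norm_num)
    have e1 : ‖∫ ω, (Z n ω - 1) * (W ω - V ω) ∂P‖ ≤ 4 * q := by
      refine (norm_integral_le_of_support P
        (S := {ω | ω ∈ A n ∧ ∃ j < n, n ≤ j + m ∧ ω ∈ A j}) (c := 4) (fun ω h => ?_)
        fun ω _ => ?_).trans (by linarith [hq n])
      · by_cases hA : ω ∈ A n
        · rw [hWVeq ω, sub_self, mul_zero]
          intro j hj hj'
          rw [Finset.mem_Ico] at hj
          exact h ⟨hA, j, hj.2, by omega, hj'⟩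
        · rw [hZA n ω hA, sub_self, zero_mul]
      · rw [norm_mul]
        calc _ ≤ (2 : ℝ) * 2 := mul_le_mul (hsub2 n ω) (hWVn ω) (norm_nonneg _) (by norm_num)
          _ = 4 := by norm_num
    have e2 : ∫ ω, (Z n ω - 1) * V ω ∂P = (z - 1) * ∫ ω, V ω ∂P := by
      rw [← hzsub]
      have hi : IndepFun (fun ω => Z n ω - 1) V P :=
        (hind n).comp (measurable_id.sub_const (1 : ℂ)) measurable_id
      exact hi.integral_fun_mul_eq_mul_integral ((hZ n).sub_const 1).aestronglyMeasurable
        (hprod _).aestronglyMeasurable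
    have e3 : ‖(∫ ω, V ω ∂P) - ∫ ω, W ω ∂P‖ ≤ 2 * (m * p) := by
      rw [← integral_sub hVint hWint]
      refine (norm_integral_le_of_support P (S := ⋃ j ∈ Finset.Ico (n - m) n, A j) (c := 2)
        (fun ω h => ?_) fun ω _ => by rw [norm_sub_rev]; exact hWVn ω).trans ?_
      · rw [hWVeq ω, sub_self]
        simpa using h
      · refine mul_le_mul_of_nonneg_left ?_ (by norm_num)
        refine (measureReal_biUnion_finset_le _ _).trans ?_
        refine (Finset.sum_le_sum fun j _ => hp j).trans ?_
        rw [Finset.sum_const, nsmul_eq_mul, Nat.card_Ico]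
        refine mul_le_mul_of_nonneg_right ?_ hp0
        exact_mod_cast (by omega : n - (n - m) ≤ m)
    -- one more factor: multiplication by `z = E Z n`, plus the clustering error, plus the error
    -- from replacing `W` by the product `V` of the factors independent of `Z n`
    have hdec : (∫ ω, ∏ i ∈ Finset.range (n + 1), Z i ω ∂P) = (∫ ω, W ω ∂P) * z
        + ((∫ ω, (Z n ω - 1) * (W ω - V ω) ∂P)
          + (z - 1) * ((∫ ω, V ω ∂P) - ∫ ω, W ω ∂P)) := by
      have h1 : ∀ ω, ∏ i ∈ Finset.range (n + 1), Z i ω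
          = W ω + ((Z n ω - 1) * (W ω - V ω) + (Z n ω - 1) * V ω) := fun ω => by
        rw [Finset.prod_range_succ]; ring
      simp_rw [h1]
      have i1 := hmulint (fun ω => W ω - V ω) ((hprod _).sub (hprod _)) hWVn
      have i2 := hmulint V (hprod _) fun ω => (hprod1 _ ω).trans (by norm_num)
      have i3 : Integrable (fun ω => (Z n ω - 1) * (W ω - V ω) + (Z n ω - 1) * V ω) P :=
        i1.add i2
      rw [integral_add hWint i3, integral_add i1 i2, e2]
      ring
    have hexp : ‖Complex.exp (z - 1) - z‖ ≤ 4 * p ^ 2 := by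
      have h1 : ‖z - 1‖ ≤ 1 := (hz2 n).trans (by linarith)
      have h2 := Complex.norm_exp_sub_one_sub_id_le h1
      have h3 : Complex.exp (z - 1) - z = Complex.exp (z - 1) - 1 - (z - 1) := by ring
      rw [h3]
      refine h2.trans ?_
      have h4 : ‖z - 1‖ ≤ 2 * p := hz2 n
      nlinarith [norm_nonneg (z - 1)]
    rw [Finset.sum_range_succ, Complex.exp_add, hdec]
    have hsplit : (∫ ω, W ω ∂P) * z + ((∫ ω, (Z n ω - 1) * (W ω - V ω) ∂P)
          + (z - 1) * ((∫ ω, V ω ∂P) - ∫ ω, W ω ∂P)) - e * Complex.exp (z - 1)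
        = ((∫ ω, W ω ∂P) - e) * z + (∫ ω, (Z n ω - 1) * (W ω - V ω) ∂P)
          + (z - 1) * ((∫ ω, V ω ∂P) - ∫ ω, W ω ∂P) - e * (Complex.exp (z - 1) - z) := by ring
    rw [hsplit]
    have b1 : ‖((∫ ω, W ω ∂P) - e) * z‖ ≤ n * (4 * q + 4 * m * p ^ 2 + 4 * p ^ 2) := by
      rw [norm_mul]
      exact (mul_le_of_le_one_right (norm_nonneg _) (hz1 n)).trans ih
    have b2 : ‖(z - 1) * ((∫ ω, V ω ∂P) - ∫ ω, W ω ∂P)‖ ≤ 2 * p * (2 * (m * p)) := by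
      rw [norm_mul]
      exact mul_le_mul (hz2 n) e3 (norm_nonneg _) (by linarith)
    have b3 : ‖e * (Complex.exp (z - 1) - z)‖ ≤ 4 * p ^ 2 := by
      rw [norm_mul]
      exact (mul_le_of_le_one_left (norm_nonneg _) (hre _)).trans hexp
    refine (norm_sub_le _ _).trans ?_
    have t1 := norm_add₃_le (a := ((∫ ω, W ω ∂P) - e) * z)
      (b := ∫ ω, (Z n ω - 1) * (W ω - V ω) ∂P)
      (c := (z - 1) * ((∫ ω, V ω ∂P) - ∫ ω, W ω ∂P))
    push_cast
    nlinarith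

/-! ### Moving averages: measurability, finite-range dependence, stationarity -/

lemma measurable_movingAverage {Ω : Type*} [MeasurableSpace Ω] {θ : ℤ →₀ ℝ} {ε : ℤ → Ω → ℝ}
    (hmeas : ∀ i, Measurable (ε i)) (i : ℤ) : Measurable (movingAverage θ ε i) :=
  Finset.measurable_fun_sum _ fun k _ => (hmeas (i + k)).const_mul (θ k)

/-- A moving average of finite order is `m`-dependent for some `m`. -/
lemma exists_indepFun_movingAverage {Ω : Type*} [MeasurableSpace Ω] {P : Measure Ω}
    {ε : ℤ → Ω → ℝ} (hmeas : ∀ i, Measurable (ε i)) (hindep : iIndepFun ε P) (θ : ℤ →₀ ℝ) :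
    ∃ m : ℕ, ∀ (a : ℤ) (T : Finset ℤ), (∀ j ∈ T, j + m ≤ a) →
      IndepFun (movingAverage θ ε a) (fun ω (j : T) => movingAverage θ ε j ω) P := by
  classical
  -- The support of `θ` lies in `[-L, L]`, and `m = 2 L + 1` separates the shifted supports.
  let L := θ.support.sup Int.natAbs
  have hL : ∀ k ∈ θ.support, k.natAbs ≤ L := fun k hk => Finset.le_sup (f := Int.natAbs) hk
  refine ⟨2 * L + 1, fun a T hT => ?_⟩
  let S₁ : Finset ℤ := θ.support.image (fun k => a + k)
  let S₂ : Finset ℤ := T.biUnion fun j => θ.support.image (fun k => j + k)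
  have hdisj : Disjoint S₁ S₂ := by
    rw [Finset.disjoint_left]
    intro x hx hx'
    simp only [S₁, S₂, Finset.mem_image, Finset.mem_biUnion] at hx hx'
    obtain ⟨k, hk, rfl⟩ := hx
    obtain ⟨j, hj, k', hk', h⟩ := hx'
    have h1 := hL k hk
    have h2 := hL k' hk'
    have h3 := hT j hj
    push_cast at h3
    omega
  have hI := hindep.indepFun_finset S₁ S₂ hdisj hmeas
  let g₁ : (S₁ → ℝ) → ℝ := fun x => ∑ k ∈ θ.support.attach,
    θ k * x ⟨a + k, Finset.mem_image_of_mem _ k.2⟩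
  let g₂ : (S₂ → ℝ) → T → ℝ := fun x j => ∑ k ∈ θ.support.attach,
    θ k * x ⟨j + k, Finset.mem_biUnion.2 ⟨j, j.2, Finset.mem_image_of_mem _ k.2⟩⟩
  have hg₁ : Measurable g₁ := Finset.measurable_fun_sum _ fun k _ =>
    (measurable_pi_apply _).const_mul _
  have hg₂ : Measurable g₂ := measurable_pi_lambda _ fun j =>
    Finset.measurable_fun_sum _ fun k _ => (measurable_pi_apply _).const_mul _
  convert! hI.comp hg₁ hg₂ using 1
  · funext ω
    exact (Finset.sum_attach θ.support fun k => θ k * ε (a + k) ω).symm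
  · funext ω j
    exact (Finset.sum_attach θ.support fun k => θ k * ε (j + k) ω).symm

/-- A moving average of independent identically distributed variables is stationary. -/
lemma identDistrib_movingAverage_shift {Ω : Type*} [MeasurableSpace Ω] {P : Measure Ω}
    {ε : ℤ → Ω → ℝ} (hindep : iIndepFun ε P)
    (hident : ∀ i, IdentDistrib (ε i) (ε 0) P P) (θ : ℤ →₀ ℝ) (a : ℤ) :
    IdentDistrib (fun ω (k : ℤ) => movingAverage θ ε (k + a) ω)
      (fun ω (k : ℤ) => movingAverage θ ε k ω) P P := by
  have h1 : IdentDistrib (fun ω (k : ℤ) => ε (k + a) ω) (fun ω (k : ℤ) => ε k ω) P P :=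
    IdentDistrib.pi (fun i => (hident (i + a)).trans (hident i).symm)
      (hindep.precomp (add_left_injective a)) hindep
  have hG : Measurable fun (x : ℤ → ℝ) (k : ℤ) => ∑ l ∈ θ.support, θ l * x (k + l) :=
    measurable_pi_lambda _ fun k => Finset.measurable_fun_sum _ fun l _ =>
      (measurable_pi_apply _).const_mul _
  convert! h1.comp hG using 1
  funext ω k
  simp only [movingAverage, Function.comp]
  refine Finset.sum_congr rfl fun l _ => ?_
  rw [show k + a + l = k + l + a by ring]

lemma measureReal_movingAverage_mem {Ω : Type*} [MeasurableSpace Ω] {P : Measure Ω}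
    {ε : ℤ → Ω → ℝ} (hindep : iIndepFun ε P)
    (hident : ∀ i, IdentDistrib (ε i) (ε 0) P P) (θ : ℤ →₀ ℝ) (a : ℤ) {B : Set ℝ}
    (hB : MeasurableSet B) :
    P.real {ω | movingAverage θ ε a ω ∈ B} = P.real {ω | movingAverage θ ε 0 ω ∈ B} := by
  have h := (identDistrib_movingAverage_shift hindep hident θ a).measure_mem_eq
    (measurable_pi_apply (0 : ℤ) hB)
  simp only [Set.preimage_preimage, zero_add] at h
  exact congrArg ENNReal.toReal h

/-- The probability of a second exceedance within `m` steps before an exceedance at time `a` is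
at most the probability of an exceedance at time `0` with another one within `m` steps. -/
lemma measureReal_cluster_le {Ω : Type*} [MeasurableSpace Ω] {P : Measure Ω}
    [IsProbabilityMeasure P] {ε : ℤ → Ω → ℝ}
    (hindep : iIndepFun ε P) (hident : ∀ i, IdentDistrib (ε i) (ε 0) P P) (θ : ℤ →₀ ℝ)
    (m : ℕ) (x : ℝ) (a : ℕ) :
    P.real {ω | x < movingAverage θ ε ((a : ℤ) + 1) ω ∧
        ∃ j < a, a ≤ j + m ∧ x < movingAverage θ ε ((j : ℤ) + 1) ω}
      ≤ P.real ({ω | x < movingAverage θ ε 0 ω} ∩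
        {ω | ∃ i : ℤ, 1 ≤ |i| ∧ |i| ≤ (m : ℤ) + 1 ∧ x < movingAverage θ ε i ω}) := by
  let S : Set (ℤ → ℝ) :=
    {y | x < y 0} ∩ ⋃ i : ℤ, ⋃ (_ : 1 ≤ |i| ∧ |i| ≤ (m : ℤ) + 1), {y | x < y i}
  have hS : MeasurableSet S :=
    (measurableSet_lt measurable_const (measurable_pi_apply _)).inter
      (MeasurableSet.iUnion fun i => MeasurableSet.iUnion fun _ =>
        measurableSet_lt measurable_const (measurable_pi_apply _))
  have h := (identDistrib_movingAverage_shift hindep hident θ (a + 1)).measure_mem_eq hS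
  have h' := congrArg ENNReal.toReal h
  rw [← measureReal_def, ← measureReal_def] at h'
  calc _ ≤ _ := measureReal_mono (fun ω hω => ?_)
    _ = _ := h'
    _ = _ := ?_
  · obtain ⟨h0, j, hj, hjm, hx⟩ := hω
    refine ⟨?_, ?_⟩
    · simpa using h0
    · simp only [Set.mem_iUnion]
      refine ⟨(j : ℤ) - a, ?_, ?_⟩
      · rw [abs_of_neg (by omega)]
        omega
      · have hj : (j : ℤ) - a + (a + 1) = j + 1 := by ring
        simpa only [Set.mem_ofPred_eq, hj] using hx
  · congr 1
    ext ω
    simp [S, and_assoc]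

/-! ### Calibrated levels -/

lemma IsCalibrated.tendsto_mul {Ω : Type*} [MeasurableSpace Ω] {P : Measure Ω}
    {X : ℤ → Ω → ℝ} {b : ℝ} {t : ℕ → ℝ} (h : IsCalibrated P X b t) :
    Tendsto (fun ν : ℕ => (ν : ℝ) * P.real {ω | t ν < X 0 ω}) atTop (𝓝 b) := by
  have h1 := h.tendsto_div_nhds_zero
  have h2 := h1.add_const b
  rw [zero_add] at h2
  refine h2.congr' ?_
  filter_upwards [eventually_gt_atTop 0] with ν hν
  have : (ν : ℝ) ≠ 0 := by positivity
  field_simp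
  ring

lemma IsCalibrated.tendsto_zero {Ω : Type*} [MeasurableSpace Ω] {P : Measure Ω}
    {X : ℤ → Ω → ℝ} {b : ℝ} {t : ℕ → ℝ} (h : IsCalibrated P X b t) :
    Tendsto (fun ν : ℕ => P.real {ω | t ν < X 0 ω}) atTop (𝓝 0) := by
  have h1 := h.tendsto_mul.mul (tendsto_inv_atTop_nhds_zero_nat (𝕜 := ℝ))
  rw [mul_zero] at h1
  refine h1.congr' ?_
  filter_upwards [eventually_gt_atTop 0] with ν hν
  have : (ν : ℝ) ≠ 0 := by positivity
  field_simp

/-- Since `X 0` has unbounded support to the right, calibrated levels tend to infinity. -/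
lemma IsCalibrated.tendsto_atTop {Ω : Type*} [MeasurableSpace Ω] {P : Measure Ω}
    [IsProbabilityMeasure P] {X : ℤ → Ω → ℝ} {b : ℝ} {t : ℕ → ℝ} (h : IsCalibrated P X b t)
    (htail : ∀ x : ℝ, 0 < P {ω | x < X 0 ω}) : Tendsto t atTop atTop := by
  refine Filter.tendsto_atTop.2 fun x => ?_
  have hx : 0 < P.real {ω | x < X 0 ω} := ENNReal.toReal_pos (htail x).ne' (measure_ne_top _ _)
  filter_upwards [h.tendsto_zero.eventually_lt_const hx] with ν hν
  by_contra! hlt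
  exact hν.not_ge (measureReal_mono fun ω hω => lt_of_le_of_lt hlt.le hω)

/-- The absence of clustering, as a statement on the ratio of unconditional probabilities. -/
lemma NoClustering.tendsto_div {Ω : Type*} [MeasurableSpace Ω] {P : Measure Ω}
    [IsProbabilityMeasure P] {X : ℤ → Ω → ℝ} (h : NoClustering P X) (hX : Measurable (X 0))
    (m : ℕ) : Tendsto (fun x : ℝ => P.real ({ω | x < X 0 ω} ∩
        {ω | ∃ i : ℤ, 1 ≤ |i| ∧ |i| ≤ (m : ℤ) + 1 ∧ x < X i ω}) / P.real {ω | x < X 0 ω})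
      atTop (𝓝 0) := by
  have h1 := (ENNReal.tendsto_toReal ENNReal.zero_ne_top).comp (h (m + 1) (by omega))
  refine h1.congr fun x => ?_
  simp only [Function.comp]
  rw [cond_apply (measurableSet_lt measurable_const hX), ENNReal.toReal_mul, ENNReal.toReal_inv,
    measureReal_def, measureReal_def, div_eq_inv_mul]

/-! ### Weak convergence of counting vectors to independent Poisson variables -/

/-- The inclusion of the lattice `ℕ^k` into Euclidean space. -/
noncomputable def latticeEmbedding (k : ℕ) (x : Fin k → ℕ) : EuclideanSpace ℝ (Fin k) :=
  WithLp.toLp 2 fun j => (x j : ℝ)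

lemma isClosedEmbedding_latticeEmbedding (k : ℕ) : IsClosedEmbedding (latticeEmbedding k) := by
  have h1 : IsClosedEmbedding (Pi.map fun (_ : Fin k) (n : ℕ) => (n : ℝ)) :=
    IsClosedEmbedding.piMap fun _ => Nat.isClosedEmbedding_coe_real
  exact (PiLp.continuousLinearEquiv 2 ℝ
    (fun _ : Fin k => ℝ)).symm.toHomeomorph.isClosedEmbedding.comp h1

lemma charFun_map_latticeEmbedding {k : ℕ} (μ : Measure (Fin k → ℕ))
    (s : EuclideanSpace ℝ (Fin k)) :
    charFun (μ.map (latticeEmbedding k)) s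
      = ∫ x, Complex.exp ((∑ j, s j * (x j : ℝ) : ℝ) * Complex.I) ∂μ := by
  rw [charFun_apply, integral_map (isClosedEmbedding_latticeEmbedding k).measurable.aemeasurable
    (by fun_prop)]
  simp [latticeEmbedding, PiLp.inner_apply]

lemma charFun_map_latticeEmbedding_pi_poissonMeasure {k : ℕ} (r : Fin k → ℝ≥0)
    (s : EuclideanSpace ℝ (Fin k)) :
    charFun ((Measure.pi fun j => poissonMeasure (r j)).map (latticeEmbedding k)) s
      = Complex.exp (∑ j, (r j : ℂ) * (Complex.exp (s j * Complex.I) - 1)) := by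
  have h1 : (Measure.pi fun j => poissonMeasure (r j)).map (latticeEmbedding k)
      = (Measure.pi fun j => (poissonMeasure (r j)).map (Nat.cast : ℕ → ℝ)).map
        (WithLp.toLp 2) := by
    rw [← Measure.pi_map_pi fun j => Measurable.of_discrete.aemeasurable,
      Measure.map_map (by fun_prop) (by fun_prop)]
    rfl
  rw [h1, charFun_pi, Complex.exp_sum]
  exact Finset.prod_congr rfl fun j _ => charFun_map_cast_poissonMeasure _ _

/-- The Lévy continuity theorem on the lattice `ℕ^k`, for a limit with independent Poisson
coordinates. Test functions on the lattice extend to Euclidean space by Tietze's theorem. -/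
theorem tendsto_pi_poissonMeasure_of_charFun {k : ℕ} (r : Fin k → ℝ≥0)
    (μ : ℕ → ProbabilityMeasure (Fin k → ℕ)) (Q : ProbabilityMeasure (Fin k → ℕ))
    (hQ : (Q : Measure (Fin k → ℕ)) = Measure.pi fun j => poissonMeasure (r j))
    (h : ∀ s : Fin k → ℝ, Tendsto
      (fun n => ∫ x : Fin k → ℕ, Complex.exp ((∑ j, s j * (x j : ℝ) : ℝ) * Complex.I)
        ∂(μ n : Measure (Fin k → ℕ)))
      atTop (𝓝 (Complex.exp (∑ j, (r j : ℂ) * (Complex.exp (s j * Complex.I) - 1))))) :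
    Tendsto μ atTop (𝓝 Q) := by
  have hemb := isClosedEmbedding_latticeEmbedding k
  have hm : Measurable (latticeEmbedding k) := hemb.measurable
  have key : Tendsto (fun n => (μ n).map hm.aemeasurable) atTop
      (𝓝 (Q.map hm.aemeasurable)) := by
    refine ProbabilityMeasure.tendsto_of_tendsto_charFun fun s => ?_
    simp only [ProbabilityMeasure.toMeasure_map]
    rw [hQ, charFun_map_latticeEmbedding_pi_poissonMeasure]
    simp_rw [charFun_map_latticeEmbedding]
    exact h s
  rw [ProbabilityMeasure.tendsto_iff_forall_integral_tendsto] at key ⊢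
  intro f
  obtain ⟨g, -, hg⟩ :=
    BoundedContinuousFunction.exists_extension_norm_eq_of_isClosedEmbedding f hemb
  have h1 : ∀ m : Measure (Fin k → ℕ), ∫ x, g x ∂(m.map (latticeEmbedding k)) = ∫ x, f x ∂m := by
    intro m
    rw [integral_map hm.aemeasurable g.continuous.measurable.aestronglyMeasurable, ← hg]
    rfl
  simpa only [ProbabilityMeasure.toMeasure_map, h1] using key g

/-- A law on `ℕ^k` with the characteristic function of independent Poisson variables is their
joint law. -/
theorem eq_pi_poissonMeasure_of_charFun {k : ℕ} (r : Fin k → ℝ≥0) (μ : Measure (Fin k → ℕ))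
    [IsProbabilityMeasure μ]
    (h : ∀ s : Fin k → ℝ, ∫ x, Complex.exp ((∑ j, s j * (x j : ℝ) : ℝ) * Complex.I) ∂μ
      = Complex.exp (∑ j, (r j : ℂ) * (Complex.exp (s j * Complex.I) - 1))) :
    μ = Measure.pi fun j => poissonMeasure (r j) := by
  have h1 := tendsto_pi_poissonMeasure_of_charFun r (fun _ => ⟨μ, inferInstance⟩)
    ⟨_, inferInstance⟩ rfl fun s => by
      simpa only [ProbabilityMeasure.coe_mk, h s] using tendsto_const_nhds
  have h2 := tendsto_nhds_unique tendsto_const_nhds h1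
  exact congrArg Subtype.val h2

/-- At most one of the alternatives `b j` holds, so the exponential of the selected sum is one
plus the selected increment. -/
lemma exp_sum_ite_eq {k : ℕ} (s : Fin k → ℝ) (b : Fin k → Prop) [DecidablePred b]
    (hb : ∀ i j, b i → b j → i = j) :
    Complex.exp ((∑ j, s j * (if b j then 1 else 0) : ℝ) * Complex.I)
      = 1 + ∑ j, (Complex.exp (s j * Complex.I) - 1) * (if b j then 1 else 0) := by
  by_cases h : ∃ i, b i
  · obtain ⟨i, hi⟩ := h
    have hne : ∀ j, j ≠ i → ¬ b j := fun j hj hbj => hj (hb j i hbj hi)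
    rw [Finset.sum_eq_single i (fun j _ hj => by simp [hne j hj]) (by simp),
      Finset.sum_eq_single i (fun j _ hj => by simp [hne j hj]) (by simp)]
    simp [hi]
  · push Not at h
    simp [h]

lemma sum_range_succ_index {M : Type*} [AddCommMonoid M] (f : ℕ → M) (n : ℕ) :
    ∑ i ∈ Finset.range n, f (i + 1) = ∑ i ∈ Finset.Icc 1 n, f i := by
  rw [Finset.range_eq_Ico, Finset.sum_Ico_add']
  rfl

open Classical in
/-- Poisson limit theorem for exceedances of a moving average. Each time `i` comes with disjoint
sets `B ν i j` of levels above `u ν`, and the expected number of visits of type `j` up to time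
`n ν` converges to `r j`. Then the numbers of visits of the various types converge jointly to
independent Poisson variables. -/
theorem tendstoInDistribution_visitCount {Ω : Type*} [MeasurableSpace Ω] {P : Measure Ω}
    [IsProbabilityMeasure P] {ε : ℤ → Ω → ℝ} (hmeas : ∀ i, Measurable (ε i))
    (hindep : iIndepFun ε P) (hident : ∀ i, IdentDistrib (ε i) (ε 0) P P) (θ : ℤ →₀ ℝ)
    (htail : ∀ x : ℝ, 0 < P {ω | x < movingAverage θ ε 0 ω})
    (hclust : NoClustering P (movingAverage θ ε))
    {k : ℕ} (r : Fin k → ℝ≥0) (n : ℕ → ℕ) (u : ℕ → ℝ) (B : ℕ → ℕ → Fin k → Set ℝ)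
    (hB : ∀ ν i j, MeasurableSet (B ν i j)) (hBu : ∀ ν i j, B ν i j ⊆ Set.Ioi (u ν))
    (hdisj : ∀ ν i, Pairwise fun j j' => Disjoint (B ν i j) (B ν i j'))
    (hu : Tendsto u atTop atTop)
    (hp : Tendsto (fun ν => P.real {ω | u ν < movingAverage θ ε 0 ω}) atTop (𝓝 0))
    (K : ℝ) (hK : ∀ᶠ ν in atTop, n ν * P.real {ω | u ν < movingAverage θ ε 0 ω} ≤ K)
    (hlim : ∀ j, Tendsto (fun ν => ∑ i ∈ Finset.Icc 1 (n ν),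
      P.real {ω | movingAverage θ ε 0 ω ∈ B ν i j}) atTop (𝓝 (r j))) :
    TendstoInDistribution (fun ν ω (j : Fin k) => ((Finset.Icc 1 (n ν)).filter
        (fun i : ℕ => movingAverage θ ε i ω ∈ B ν i j)).card) atTop
      (id : (Fin k → ℕ) → (Fin k → ℕ)) (fun _ => P)
      (Measure.pi fun j => poissonMeasure (r j)) := by
  have hX := measurable_movingAverage (θ := θ) hmeas
  set X := movingAverage θ ε with hXdef
  have hN : ∀ ν, Measurable fun ω (j : Fin k) => ((Finset.Icc 1 (n ν)).filter
      (fun i : ℕ => X i ω ∈ B ν i j)).card := fun ν => by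
    refine measurable_pi_lambda _ fun j => ?_
    simp_rw [Finset.card_filter]
    exact Finset.measurable_fun_sum _ fun i _ =>
      Measurable.ite (hX i (hB ν i j)) measurable_const measurable_const
  have key := tendsto_pi_poissonMeasure_of_charFun r
    (fun ν => ⟨P.map fun ω (j : Fin k) => ((Finset.Icc 1 (n ν)).filter
      (fun i : ℕ => X i ω ∈ B ν i j)).card,
      Measure.isProbabilityMeasure_map (hN ν).aemeasurable⟩)
    ⟨_, Measure.isProbabilityMeasure_map aemeasurable_id⟩ Measure.map_id ?_
  · exact ⟨fun ν => (hN ν).aemeasurable, aemeasurable_id, key⟩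
  intro s
  obtain ⟨m, hm⟩ := exists_indepFun_movingAverage hmeas hindep θ
  -- the factor contributed by time `i + 1`, as a function of the level
  let w : ℕ → ℕ → ℝ → ℂ := fun ν i x =>
    Complex.exp ((∑ j, s j * (if x ∈ B ν (i + 1) j then 1 else 0) : ℝ) * Complex.I)
  have hw : ∀ ν i, Measurable (w ν i) := fun ν i => by
    refine Complex.measurable_exp.comp (Measurable.mul_const (Complex.measurable_ofReal.comp ?_) _)
    exact Finset.measurable_fun_sum _ fun j _ =>
      (Measurable.ite (hB ν (i + 1) j) measurable_const measurable_const).const_mul _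
  have hw1 : ∀ ν i x, ‖w ν i x‖ ≤ 1 := fun ν i x => (Complex.norm_exp_ofReal_mul_I _).le
  have hwu : ∀ ν i x, ¬ u ν < x → w ν i x = 1 := fun ν i x hx => by
    have : ∀ j, x ∉ B ν (i + 1) j := fun j h => hx (hBu ν (i + 1) j h)
    simp [w, this]
  let Z : ℕ → ℕ → Ω → ℂ := fun ν i ω => w ν i (X ((i : ℤ) + 1) ω)
  let p : ℕ → ℝ := fun ν => P.real {ω | u ν < X 0 ω}
  let q : ℕ → ℝ := fun ν => P.real ({ω | u ν < X 0 ω} ∩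
    {ω | ∃ i : ℤ, 1 ≤ |i| ∧ |i| ≤ (m : ℤ) + 1 ∧ u ν < X i ω})
  have hp0 : ∀ ν, 0 < p ν := fun ν => ENNReal.toReal_pos (htail _).ne' (measure_ne_top _ _)
  have hchar : ∀ ν, ∫ x, Complex.exp ((∑ j, s j * (x j : ℝ) : ℝ) * Complex.I)
        ∂(P.map fun ω (j : Fin k) => ((Finset.Icc 1 (n ν)).filter
          (fun i : ℕ => X i ω ∈ B ν i j)).card)
      = ∫ ω, ∏ i ∈ Finset.range (n ν), Z ν i ω ∂P := fun ν => by
    rw [integral_map (hN ν).aemeasurable Measurable.of_discrete.aestronglyMeasurable]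
    congr 1
    funext ω
    rw [← Complex.exp_sum, ← Finset.sum_mul, ← Complex.ofReal_sum, Finset.sum_comm]
    congr 3
    refine Finset.sum_congr rfl fun j _ => ?_
    beta_reduce
    rw [← Finset.mul_sum, Finset.card_filter, ← sum_range_succ_index]
    push_cast
    rfl
  have hmean : ∀ ν, ∑ i ∈ Finset.range (n ν), ((∫ ω, Z ν i ω ∂P) - 1)
      = ∑ j, (Complex.exp (s j * Complex.I) - 1) *
        ((∑ i ∈ Finset.Icc 1 (n ν), P.real {ω | X 0 ω ∈ B ν i j} : ℝ) : ℂ) := fun ν => by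
    have h1 : ∀ i, (∫ ω, Z ν i ω ∂P) - 1 = ∑ j, (Complex.exp (s j * Complex.I) - 1) *
        (P.real {ω | X 0 ω ∈ B ν (i + 1) j} : ℂ) := fun i => by
      have h2 : ∀ ω, Z ν i ω = 1 + ∑ j, (Complex.exp (s j * Complex.I) - 1) *
          ({ω | X ((i : ℤ) + 1) ω ∈ B ν (i + 1) j}.indicator (fun _ => (1 : ℂ)) ω) := fun ω => by
        simp only [Z, w]
        rw [exp_sum_ite_eq]
        · rfl
        · intro j j' hj hj'
          by_contra hne
          exact Set.disjoint_left.1 (hdisj ν (i + 1) hne) hj hj'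
      have hS : ∀ j, MeasurableSet {ω | X ((i : ℤ) + 1) ω ∈ B ν (i + 1) j} := fun j =>
        hX _ (hB ν (i + 1) j)
      have hi : ∀ j, Integrable (fun ω => (Complex.exp (s j * Complex.I) - 1) *
          ({ω | X ((i : ℤ) + 1) ω ∈ B ν (i + 1) j}.indicator (fun _ => (1 : ℂ)) ω)) P := fun j =>
        ((integrable_const _).indicator (hS j)).const_mul _
      simp_rw [h2]
      rw [integral_add (integrable_const _) (integrable_finsetSum _ fun j _ => hi j),
        integral_finsetSum _ fun j _ => hi j]
      simp only [integral_const, probReal_univ, one_smul, add_sub_cancel_left]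
      refine Finset.sum_congr rfl fun j _ => ?_
      rw [integral_const_mul, integral_indicator_const _ (hS j),
        measureReal_movingAverage_mem hindep hident θ _ (hB ν (i + 1) j), ← hXdef]
      simp
    simp_rw [h1]
    rw [Finset.sum_comm]
    refine Finset.sum_congr rfl fun j _ => ?_
    rw [← Finset.mul_sum, ← sum_range_succ_index]
    push_cast
    rfl
  have hexp : Tendsto (fun ν => Complex.exp (∑ i ∈ Finset.range (n ν), ((∫ ω, Z ν i ω ∂P) - 1)))
      atTop (𝓝 (Complex.exp (∑ j, (r j : ℂ) * (Complex.exp (s j * Complex.I) - 1)))) := by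
    refine (Complex.continuous_exp.tendsto _).comp ?_
    simp_rw [hmean]
    refine tendsto_finsetSum _ fun j _ => ?_
    rw [mul_comm (r j : ℂ)]
    exact ((Complex.continuous_ofReal.tendsto _).comp (hlim j)).const_mul _
  have hbound : ∀ ν, p ν ≤ 1 / 2 → ‖(∫ ω, ∏ i ∈ Finset.range (n ν), Z ν i ω ∂P)
      - Complex.exp (∑ i ∈ Finset.range (n ν), ((∫ ω, Z ν i ω ∂P) - 1))‖
      ≤ n ν * (4 * q ν + 4 * m * p ν ^ 2 + 4 * p ν ^ 2) := fun ν hν => by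
    refine norm_integral_prod_sub_exp_le P (Z ν) (fun i => {ω | u ν < X ((i : ℤ) + 1) ω}) m (p ν)
      (q ν) (fun i => (hw ν i).comp (hX _)) (fun i ω => hw1 ν i _) (fun i ω h => hwu ν i _ h)
      (fun i => (measureReal_movingAverage_mem hindep hident θ _ measurableSet_Ioi).le) hν
      (fun i => measureReal_cluster_le hindep hident θ m (u ν) i) (fun i => ?_) _
    have hT := hm ((i : ℤ) + 1)
      ((Finset.range (i - m)).image fun j : ℕ => (j : ℤ) + 1) (fun j hj => by
        simp only [Finset.mem_image, Finset.mem_range] at hj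
        obtain ⟨l, hl, rfl⟩ := hj
        omega)
    have hg : Measurable fun (y : ((Finset.range (i - m)).image fun j : ℕ => (j : ℤ) + 1) → ℝ) =>
        ∏ j ∈ (Finset.range (i - m)).attach,
          w ν j (y ⟨(j : ℤ) + 1, Finset.mem_image_of_mem _ j.2⟩) :=
      Finset.measurable_fun_prod _ fun j _ => (hw ν j).comp (measurable_pi_apply _)
    convert! hT.comp (hw ν i) hg using 1
    funext ω
    exact (Finset.prod_attach (Finset.range (i - m)) fun j => Z ν j ω).symm
  -- `n p` is bounded by `K`, and `q / p` is the conditional probability of clustering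
  have herr : Tendsto (fun ν => K * (4 * (q ν / p ν) + 4 * m * p ν + 4 * p ν)) atTop (𝓝 0) := by
    have h1 : Tendsto (fun ν => q ν / p ν) atTop (𝓝 0) :=
      (hclust.tendsto_div (hX 0) m).comp hu
    simpa using (((h1.const_mul 4).add (hp.const_mul (4 * (m : ℝ)))).add
      (hp.const_mul 4)).const_mul K
  simp only [ProbabilityMeasure.coe_mk, hchar]
  have hdiff : Tendsto (fun ν => (∫ ω, ∏ i ∈ Finset.range (n ν), Z ν i ω ∂P)
      - Complex.exp (∑ i ∈ Finset.range (n ν), ((∫ ω, Z ν i ω ∂P) - 1))) atTop (𝓝 0) := by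
    refine squeeze_zero_norm' ?_ herr
    filter_upwards [hK, hp.eventually_le_const (by norm_num : (0 : ℝ) < 1 / 2)] with ν h1 h2
    refine (hbound ν h2).trans ?_
    have hq0 : 0 ≤ q ν := measureReal_nonneg
    have h3 : 0 ≤ 4 * (q ν / p ν) + 4 * m * p ν + 4 * p ν := by
      have := hp0 ν
      positivity
    calc (n ν : ℝ) * (4 * q ν + 4 * m * p ν ^ 2 + 4 * p ν ^ 2)
        = (n ν * p ν) * (4 * (q ν / p ν) + 4 * m * p ν + 4 * p ν) := by
          have := (hp0 ν).ne'
          field_simp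
      _ ≤ K * (4 * (q ν / p ν) + 4 * m * p ν + 4 * p ν) := mul_le_mul_of_nonneg_right h1 h3
  simpa using hdiff.add hexp

/-! ### Weak convergence of random configurations from their cell counts -/

lemma toMeasure_pointMass {S : Type*} [MeasurableSpace S] (x : S) :
    (pointMass x : Measure S) = Measure.dirac x := rfl

lemma continuous_pointMass {S : Type*} [MeasurableSpace S] [TopologicalSpace S]
    [OpensMeasurableSpace S] : Continuous (pointMass : S → FiniteMeasure S) :=
  ProbabilityMeasure.toFiniteMeasure_continuous.comp continuous_diracProba

lemma continuous_sum_pointMass {S ι : Type*} [MeasurableSpace S] [TopologicalSpace S]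
    [OpensMeasurableSpace S] [Fintype ι] :
    Continuous fun x : ι → S => ∑ i, pointMass (x i) :=
  continuous_finsetSum _ fun i _ => continuous_pointMass.comp (continuous_apply i)

/-- A random configuration, given by a random finite index set and random points, is a random
element of the space of finite measures. -/
lemma measurable_sum_pointMass {Ω E : Type*} [MeasurableSpace Ω] [MeasurableSpace E]
    [TopologicalSpace E] [SecondCountableTopology E] [BorelSpace E] {T : Ω → Finset ℕ}
    (hT : ∀ S, MeasurableSet {ω | T ω = S}) {x : ℕ → Ω → E} (hx : ∀ i, Measurable (x i)) :
    Measurable[_, borel (FiniteMeasure E)] fun ω => ∑ i ∈ T ω, pointMass (x i ω) := by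
  intro A hA
  have h1 : (fun ω => ∑ i ∈ T ω, pointMass (x i ω)) ⁻¹' A
      = ⋃ S : Finset ℕ, {ω | T ω = S} ∩
        (fun ω (i : S) => x i ω) ⁻¹' ((fun y : S → E => ∑ i, pointMass (y i)) ⁻¹' A) := by
    ext ω
    simp only [Set.mem_preimage, Set.mem_iUnion, Set.mem_inter_iff, Set.mem_ofPred_eq]
    rw [exists_eq_left', Finset.sum_coe_sort (T ω) fun i => pointMass (x i ω)]
  rw [h1]
  refine MeasurableSet.iUnion fun S => (hT S).inter ?_
  refine measurable_pi_lambda (fun ω (i : S) => x i ω) (fun i => hx i) ?_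
  have h2 := continuous_sum_pointMass (S := E) (ι := S)
  exact BorelSpace.measurable_eq (α := S → E) ▸ h2.borel_measurable hA

/-- On configurations with at most `K` points a continuous functional depends uniformly
continuously on the positions of the points, since these vary in a compact space. -/
lemma exists_dist_map_sum_pointMass_le {E : Type*} [MeasurableSpace E] [PseudoMetricSpace E]
    [CompactSpace E] [OpensMeasurableSpace E] {F : FiniteMeasure E → ℝ} (hF : Continuous F)
    (K : ℕ) {δ : ℝ} (hδ : 0 < δ) :
    ∃ η > 0, ∀ (T : Finset ℕ) (x y : ℕ → E), T.card ≤ K → (∀ i ∈ T, dist (x i) (y i) < η) →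
      |F (∑ i ∈ T, pointMass (x i)) - F (∑ i ∈ T, pointMass (y i))| ≤ δ := by
  have h1 : ∀ n : ℕ, ∃ η > 0, ∀ x y : Fin n → E, dist x y < η →
      dist (F (∑ i, pointMass (x i))) (F (∑ i, pointMass (y i))) < δ := fun n => by
    have hu := CompactSpace.uniformContinuous_of_continuous
      (hF.comp (continuous_sum_pointMass (S := E) (ι := Fin n)))
    obtain ⟨η, h0, h⟩ := Metric.uniformContinuous_iff.1 hu δ hδ
    exact ⟨η, h0, fun x y hxy => h hxy⟩
  choose η hη0 hη using h1
  have hne : (Finset.range (K + 1)).Nonempty := ⟨0, by simp⟩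
  refine ⟨(Finset.range (K + 1)).inf' hne η, by simp [Finset.lt_inf'_iff, hη0], ?_⟩
  intro T x y hT hxy
  have hsum : ∀ z : ℕ → E, ∑ i ∈ T, pointMass (z i)
      = ∑ l : Fin T.card, pointMass (z (T.equivFin.symm l)) := fun z => by
    rw [← Finset.sum_coe_sort T fun i => pointMass (z i)]
    exact (T.equivFin.symm.sum_comp fun i : T => pointMass (z i)).symm
  rw [hsum, hsum, ← Real.dist_eq]
  refine (hη T.card _ _ ?_).le
  rw [dist_pi_lt_iff (hη0 _)]
  intro l
  exact (hxy _ (T.equivFin.symm l).2).trans_le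
    (Finset.inf'_le _ (Finset.mem_range.2 (Nat.lt_succ_of_le hT)))

lemma measurableSet_lt_card {Ω : Type*} [MeasurableSpace Ω] {T : Ω → Finset ℕ}
    (hT : ∀ S, MeasurableSet {ω | T ω = S}) (K : ℕ) : MeasurableSet {ω | K < (T ω).card} := by
  have : {ω | K < (T ω).card} = ⋃ S : {S : Finset ℕ // K < S.card}, {ω | T ω = S} := by
    ext ω
    simp
  rw [this]
  exact MeasurableSet.iUnion fun S => hT S

/-- Moving all points by less than `η` changes the expectation of a functional by little, apart
from the contribution of the configurations with more than `K` points. -/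
lemma abs_integral_sub_integral_le {Ω E : Type*} [MeasurableSpace Ω] (P : Measure Ω)
    [IsProbabilityMeasure P] [MeasurableSpace E] [PseudoMetricSpace E] [CompactSpace E]
    [BorelSpace E] (F : FiniteMeasure E →ᵇ ℝ) {K : ℕ} {δ η : ℝ} (hδ : 0 < δ)
    (h : ∀ (T : Finset ℕ) (x y : ℕ → E), T.card ≤ K → (∀ i ∈ T, dist (x i) (y i) < η) →
      |F (∑ i ∈ T, pointMass (x i)) - F (∑ i ∈ T, pointMass (y i))| ≤ δ)
    {T : Ω → Finset ℕ} (hT : ∀ S, MeasurableSet {ω | T ω = S}) {x y : ℕ → Ω → E}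
    (hx : ∀ i, Measurable (x i)) (hy : ∀ i, Measurable (y i))
    (hxy : ∀ i ω, dist (x i ω) (y i ω) < η) :
    |(∫ ω, F (∑ i ∈ T ω, pointMass (x i ω)) ∂P) - ∫ ω, F (∑ i ∈ T ω, pointMass (y i ω)) ∂P|
      ≤ δ + 2 * ‖F‖ * P.real {ω | K < (T ω).card} := by
  have hint : ∀ z : ℕ → Ω → E, (∀ i, Measurable (z i)) →
      Integrable (fun ω => F (∑ i ∈ T ω, pointMass (z i ω))) P := fun z hz => by
    have hm : Measurable fun ω => F (∑ i ∈ T ω, pointMass (z i ω)) :=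
      @Measurable.comp _ _ _ _ (borel _) _ _ _ F.continuous.borel_measurable
        (measurable_sum_pointMass hT hz)
    exact Integrable.of_bound hm.aestronglyMeasurable ‖F‖
      (ae_of_all _ fun ω => F.norm_coe_le_norm _)
  have hS := measurableSet_lt_card hT K
  rw [← integral_sub (hint x hx) (hint y hy)]
  refine abs_integral_le_integral_abs.trans ?_
  have hle : ∀ ω, |F (∑ i ∈ T ω, pointMass (x i ω)) - F (∑ i ∈ T ω, pointMass (y i ω))|
      ≤ δ + {ω | K < (T ω).card}.indicator (fun _ => 2 * ‖F‖) ω := fun ω => by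
    by_cases hω : K < (T ω).card
    · have hω' : ω ∈ {ω | K < (T ω).card} := hω
      rw [Set.indicator_of_mem hω']
      have h1 := F.dist_le_two_norm (∑ i ∈ T ω, pointMass (x i ω)) (∑ i ∈ T ω, pointMass (y i ω))
      rw [Real.dist_eq] at h1
      linarith
    · have hω' : ω ∉ {ω | K < (T ω).card} := hω
      rw [Set.indicator_of_notMem hω', add_zero]
      exact h (T ω) (fun i => x i ω) (fun i => y i ω) (not_lt.1 hω) fun i _ => hxy i ω
  have hI : Integrable ({ω | K < (T ω).card}.indicator (fun _ => 2 * ‖F‖)) P :=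
    (integrable_const _).indicator hS
  refine (integral_mono ((hint x hx).sub (hint y hy)).abs ((integrable_const δ).add hI)
    hle).trans ?_
  rw [integral_add' (integrable_const δ) hI, integral_indicator_const _ hS]
  simp [mul_comm]

/-- The number of points of a random configuration in each of finitely many cells. -/
def cellCount {Ω E : Type*} {M : ℕ} (cell : E → Fin M) (T : Ω → Finset ℕ) (x : ℕ → Ω → E)
    (ω : Ω) (j : Fin M) : ℕ :=
  ((T ω).filter fun i => cell (x i ω) = j).card

lemma sum_cellCount {Ω E : Type*} {M : ℕ} (cell : E → Fin M) (T : Ω → Finset ℕ)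
    (x : ℕ → Ω → E) (ω : Ω) : ∑ j, cellCount cell T x ω j = (T ω).card :=
  (Finset.card_eq_sum_card_fiberwise fun _ _ => Finset.mem_coe.2 (Finset.mem_univ _)).symm

lemma sum_cellCount_smul {Ω E : Type*} [MeasurableSpace E] {M : ℕ} (cell : E → Fin M)
    (c : Fin M → E) (T : Ω → Finset ℕ) (x : ℕ → Ω → E) (ω : Ω) :
    ∑ j, cellCount cell T x ω j • pointMass (c j)
      = ∑ i ∈ T ω, pointMass (c (cell (x i ω))) := by
  rw [← Finset.sum_fiberwise (T ω) (fun i => cell (x i ω))]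
  refine Finset.sum_congr rfl fun j _ => ?_
  rw [Finset.sum_congr rfl (g := fun _ => pointMass (c j)) fun i hi => by
    rw [(Finset.mem_filter.1 hi).2], Finset.sum_const]
  rfl

lemma integral_ite_lt_sum_cellCount {Ω E : Type*} [MeasurableSpace Ω] (P : Measure Ω)
    {T : Ω → Finset ℕ} (hT : ∀ S, MeasurableSet {ω | T ω = S}) (x : ℕ → Ω → E) {M : ℕ}
    (cell : E → Fin M) (K : ℕ) :
    ∫ ω, (if K < ∑ j, cellCount cell T x ω j then (1 : ℝ) else 0) ∂P
      = P.real {ω | K < (T ω).card} := by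
  have h1 : ∀ ω, (if K < ∑ j, cellCount cell T x ω j then (1 : ℝ) else 0)
      = {ω | K < (T ω).card}.indicator (fun _ => (1 : ℝ)) ω := fun ω => by
    rw [sum_cellCount, Set.indicator_apply]
    simp
  simp_rw [h1]
  rw [integral_indicator_const _ (measurableSet_lt_card hT K), smul_eq_mul, mul_one]

/-- Random configurations in a compact metric space converge weakly as soon as, for arbitrarily
fine partitions, their cell counts converge in distribution. Rounding every point to a
representative of its cell makes a functional of the configuration a functional of the cell
counts, and these also control the number of points. -/
theorem convergesWeakly_of_cellCount {Ω Ω' E : Type*} [MeasurableSpace Ω] [MeasurableSpace Ω']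
    {P : Measure Ω} [IsProbabilityMeasure P] {P' : Measure Ω'} [IsProbabilityMeasure P']
    [MeasurableSpace E] [PseudoMetricSpace E] [CompactSpace E] [BorelSpace E]
    {T : ℕ → Ω → Finset ℕ} (hT : ∀ ν S, MeasurableSet {ω | T ν ω = S})
    {x : ℕ → ℕ → Ω → E} (hx : ∀ ν i, Measurable (x ν i))
    {T' : Ω' → Finset ℕ} (hT' : ∀ S, MeasurableSet {ω | T' ω = S})
    {x' : ℕ → Ω' → E} (hx' : ∀ i, Measurable (x' i))
    (h : ∀ η > 0, ∃ (M : ℕ) (cell : E → Fin M) (c : Fin M → E), Measurable cell ∧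
      (∀ y, dist y (c (cell y)) < η) ∧ ∀ f : (Fin M → ℕ) →ᵇ ℝ,
        Tendsto (fun ν => ∫ ω, f (cellCount cell (T ν) (x ν) ω) ∂P) atTop
          (𝓝 (∫ ω, f (cellCount cell T' x' ω) ∂P'))) :
    ConvergesWeakly P (fun ν ω => ∑ i ∈ T ν ω, pointMass (x ν i ω)) P'
      (fun ω => ∑ i ∈ T' ω, pointMass (x' i ω)) := by
  refine ⟨fun ν => measurable_sum_pointMass (hT ν) (hx ν), measurable_sum_pointMass hT' hx',
    fun F => ?_⟩
  rw [Metric.tendsto_atTop']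
  intro δ hδ
  set a : ℝ := δ / (16 * (‖F‖ + 1)) with ha
  have hF0 := norm_nonneg F
  have ha0 : 0 < a := by positivity
  have haF : 2 * ‖F‖ * a ≤ δ / 8 := by
    rw [ha, mul_div_assoc', div_le_div_iff₀ (by positivity) (by norm_num)]
    nlinarith
  -- the limit configuration has at most `K` points with high probability
  obtain ⟨K, hK⟩ : ∃ K : ℕ, P'.real {ω | K < (T' ω).card} < a := by
    have h1 : Tendsto (fun K : ℕ => P' {ω | K < (T' ω).card}) atTop
        (𝓝 (P' (⋂ K : ℕ, {ω | K < (T' ω).card}))) :=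
      tendsto_measure_iInter_atTop (fun K => (measurableSet_lt_card hT' K).nullMeasurableSet)
        (fun K K' hKK' ω hω => lt_of_le_of_lt hKK' hω) ⟨0, measure_ne_top _ _⟩
    have h2 : (⋂ K : ℕ, {ω | K < (T' ω).card}) = ∅ := by
      ext ω
      simp only [Set.mem_iInter, Set.mem_ofPred_eq, Set.mem_empty_iff_false, iff_false, not_forall]
      exact ⟨_, lt_irrefl _⟩
    rw [h2, measure_empty] at h1
    have h3 := (ENNReal.tendsto_toReal ENNReal.zero_ne_top).comp h1
    exact (h3.eventually_lt_const ha0).exists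
  obtain ⟨η, hη0, hη⟩ := exists_dist_map_sum_pointMass_le F.continuous K
    (by positivity : 0 < δ / 8)
  obtain ⟨M, cell, c, hcell, hdist, hlim⟩ := h η hη0
  -- as functions of the cell counts: the functional at the rounded configuration, and the
  -- indicator of more than `K` points
  let f₁ : (Fin M → ℕ) →ᵇ ℝ := BoundedContinuousFunction.ofNormedAddCommGroupDiscrete
    (fun n => F (∑ j, n j • pointMass (c j))) ‖F‖ fun n => F.norm_coe_le_norm _
  let f₂ : (Fin M → ℕ) →ᵇ ℝ := BoundedContinuousFunction.ofNormedAddCommGroupDiscrete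
    (fun n => if K < ∑ j, n j then 1 else 0) 1 fun n => by split_ifs <;> simp
  have hl₁ : Tendsto (fun ν => ∫ ω, F (∑ i ∈ T ν ω, pointMass (c (cell (x ν i ω)))) ∂P) atTop
      (𝓝 (∫ ω, F (∑ i ∈ T' ω, pointMass (c (cell (x' i ω)))) ∂P')) := by
    have h1 := hlim f₁
    change Tendsto
      (fun ν => ∫ ω, F (∑ j, cellCount cell (T ν) (x ν) ω j • pointMass (c j)) ∂P) atTop
      (𝓝 (∫ ω, F (∑ j, cellCount cell T' x' ω j • pointMass (c j)) ∂P')) at h1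
    simpa only [sum_cellCount_smul] using h1
  have hl₂ : Tendsto (fun ν => P.real {ω | K < (T ν ω).card}) atTop
      (𝓝 (P'.real {ω | K < (T' ω).card})) := by
    have h1 := hlim f₂
    change Tendsto
      (fun ν => ∫ ω, (if K < ∑ j, cellCount cell (T ν) (x ν) ω j then (1 : ℝ) else 0) ∂P) atTop
      (𝓝 (∫ ω, (if K < ∑ j, cellCount cell T' x' ω j then (1 : ℝ) else 0) ∂P')) at h1
    simpa only [integral_ite_lt_sum_cellCount P' hT',
      integral_ite_lt_sum_cellCount P (hT _)] using h1
  have hev₁ := Metric.tendsto_nhds.1 hl₁ (δ / 8) (by positivity)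
  have hev₂ := hl₂.eventually_lt_const hK
  obtain ⟨ν₀, hν₀⟩ := eventually_atTop.1 (hev₁.and hev₂)
  refine ⟨ν₀, fun ν hν => ?_⟩
  obtain ⟨h1, h2⟩ := hν₀ ν hν.le
  have h3 := abs_integral_sub_integral_le P F (by positivity : 0 < δ / 8) hη (hT ν) (hx ν)
    (fun i => (measurable_of_finite c).comp (hcell.comp (hx ν i))) fun i ω => hdist _
  have h4 := abs_integral_sub_integral_le P' F (by positivity : 0 < δ / 8) hη hT' hx'
    (fun i => (measurable_of_finite c).comp (hcell.comp (hx' i))) fun i ω => hdist _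
  have h5 : 2 * ‖F‖ * P.real {ω | K < (T ν ω).card} ≤ δ / 8 :=
    (mul_le_mul_of_nonneg_left h2.le (by positivity)).trans haF
  have h6 : 2 * ‖F‖ * P'.real {ω | K < (T' ω).card} ≤ δ / 8 :=
    (mul_le_mul_of_nonneg_left hK.le (by positivity)).trans haF
  rw [Real.dist_eq] at h1 ⊢
  rw [abs_lt] at h1 ⊢
  rw [abs_le] at h3 h4
  simp only [Function.comp_apply] at h3 h4
  constructor <;> linarith

/-! ### The mixed binomial construction of the Poisson process -/

section PoissonProcess

variable {E : Type*} [MeasurableSpace E]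

/-- The law of a Poisson number of mean `r` together with an independent sequence of independent
points with law `ρ`. The first points, as many as this number, form a Poisson process with
intensity measure `r ρ`. -/
noncomputable def poissonSampleMeasure (r : ℝ≥0) (ρ : Measure E) [IsProbabilityMeasure ρ] :
    Measure (ℕ × (ℕ → E)) :=
  (poissonMeasure r).prod (Measure.infinitePi fun _ => ρ)

instance (r : ℝ≥0) (ρ : Measure E) [IsProbabilityMeasure ρ] :
    IsProbabilityMeasure (poissonSampleMeasure r ρ) := by
  unfold poissonSampleMeasure
  infer_instance

/-- The multiplicative functionals of the Poisson sample. -/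
lemma integral_prod_poissonSampleMeasure (r : ℝ≥0) (ρ : Measure E) [IsProbabilityMeasure ρ]
    {h : E → ℂ} (hm : Measurable h) (h1 : ∀ y, ‖h y‖ ≤ 1) :
    ∫ ω, ∏ i ∈ Finset.range ω.1, h (ω.2 i) ∂(poissonSampleMeasure r ρ)
      = Complex.exp (r * ((∫ y, h y ∂ρ) - 1)) := by
  have hmeas : Measurable fun ω : ℕ × (ℕ → E) => ∏ i ∈ Finset.range ω.1, h (ω.2 i) :=
    measurable_from_prod_countable_right fun n =>
      Finset.measurable_fun_prod (Finset.range n) fun i _ => hm.comp (measurable_pi_apply i)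
  have hint : Integrable (fun ω : ℕ × (ℕ → E) => ∏ i ∈ Finset.range ω.1, h (ω.2 i))
      ((poissonMeasure r).prod (Measure.infinitePi fun _ => ρ)) :=
    Integrable.of_bound hmeas.aestronglyMeasurable 1 (ae_of_all _ fun ω => by
      rw [norm_prod]
      exact Finset.prod_le_one (fun i _ => norm_nonneg _) fun i _ => h1 _)
  have hpow : ∀ n : ℕ, ∫ y : ℕ → E, ∏ i ∈ Finset.range n, h (y i)
      ∂(Measure.infinitePi fun _ => ρ) = (∫ y, h y ∂ρ) ^ n := fun n => by
    have hi : iIndepFun (fun (i : Fin n) (y : ℕ → E) => h (y i))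
        (Measure.infinitePi fun _ => ρ) :=
      (iIndepFun_infinitePi (P := fun _ : ℕ => ρ) (X := fun _ => h) fun _ => hm).precomp
        Fin.val_injective
    simp_rw [Finset.prod_range]
    rw [hi.integral_fun_prod_eq_prod_integral fun i =>
      (hm.comp (measurable_pi_apply _)).aestronglyMeasurable]
    have h2 : ∀ i : Fin n, ∫ y : ℕ → E, h (y i) ∂(Measure.infinitePi fun _ => ρ)
        = ∫ y, h y ∂ρ := fun i => by
      have h3 := measurePreserving_eval_infinitePi (fun _ : ℕ => ρ) (i : ℕ)
      conv_rhs => rw [← h3.map_eq]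
      rw [integral_map h3.measurable.aemeasurable hm.aestronglyMeasurable]
    simp [h2]
  rw [poissonSampleMeasure, integral_prod _ hint]
  simp_rw [hpow]
  set z := ∫ y, h y ∂ρ
  rw [integral_poissonMeasure]
  calc ∑' n : ℕ, (Real.exp (-r) * r ^ n / n ! : ℝ) • z ^ n
      = ∑' n : ℕ, (Real.exp (-r) : ℂ) * ((r * z) ^ n / n !) := by
        congr with n
        rw [Complex.real_smul]
        push_cast
        rw [mul_pow]
        ring
    _ = (Real.exp (-r) : ℂ) * Complex.exp (r * z) := by
        rw [tsum_mul_left, (NormedSpace.expSeries_div_hasSum_exp ((r : ℂ) * z)).tsum_eq,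
          Complex.exp_eq_exp_ℂ]
    _ = Complex.exp (r * (z - 1)) := by
        rw [Complex.ofReal_exp, ← Complex.exp_add]
        push_cast
        ring_nf

open Classical in
/-- The number of points of the Poisson sample that lie in `B`. -/
noncomputable def sampleCount (B : Set E) (ω : ℕ × (ℕ → E)) : ℕ :=
  ((Finset.range ω.1).filter fun i => ω.2 i ∈ B).card

lemma measurable_sampleCount {B : Set E} (hB : MeasurableSet B) :
    Measurable (sampleCount B) := by
  refine measurable_from_prod_countable_right fun n => ?_
  simp only [sampleCount, Finset.card_filter]
  exact Finset.measurable_fun_sum _ fun i _ =>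
    Measurable.ite (measurable_pi_apply i hB) measurable_const measurable_const

/-- The numbers of points in disjoint sets are independent Poisson variables. -/
theorem map_sampleCount_eq_pi (r : ℝ≥0) (ρ : Measure E) [IsProbabilityMeasure ρ] {k : ℕ}
    {B : Fin k → Set E} (hB : ∀ j, MeasurableSet (B j))
    (hdisj : Pairwise fun i j => Disjoint (B i) (B j)) :
    (poissonSampleMeasure r ρ).map (fun ω j => sampleCount (B j) ω)
      = Measure.pi fun j => poissonMeasure (r * (ρ (B j)).toNNReal) := by
  classical
  have hN : Measurable fun ω j => sampleCount (B j) ω :=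
    measurable_pi_lambda _ fun j => measurable_sampleCount (hB j)
  have : IsProbabilityMeasure ((poissonSampleMeasure r ρ).map fun ω j => sampleCount (B j) ω) :=
    Measure.isProbabilityMeasure_map hN.aemeasurable
  refine eq_pi_poissonMeasure_of_charFun _ _ fun s => ?_
  rw [integral_map hN.aemeasurable Measurable.of_discrete.aestronglyMeasurable]
  let h : E → ℂ := fun y =>
    Complex.exp ((∑ j, s j * (if y ∈ B j then 1 else 0) : ℝ) * Complex.I)
  have hh : ∀ y, h y = 1 + ∑ j, (Complex.exp (s j * Complex.I) - 1) *
      ((B j).indicator (fun _ => (1 : ℂ)) y) := fun y => by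
    simp only [h]
    rw [exp_sum_ite_eq]
    · rfl
    · intro i j hi hj
      by_contra hne
      exact Set.disjoint_left.1 (hdisj hne) hi hj
  have hm : Measurable h := by
    refine Complex.measurable_exp.comp (Measurable.mul_const (Complex.measurable_ofReal.comp ?_) _)
    exact Finset.measurable_fun_sum _ fun j _ =>
      (Measurable.ite (hB j) measurable_const measurable_const).const_mul _
  have hint : ∀ j, Integrable (fun y => (Complex.exp (s j * Complex.I) - 1) *
      ((B j).indicator (fun _ => (1 : ℂ)) y)) ρ := fun j =>
    ((integrable_const _).indicator (hB j)).const_mul _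
  have hmean : (∫ y, h y ∂ρ) - 1
      = ∑ j, (Complex.exp (s j * Complex.I) - 1) * (ρ.real (B j) : ℂ) := by
    simp_rw [hh]
    rw [integral_add (integrable_const _) (integrable_finsetSum _ fun j _ => hint j),
      integral_finsetSum _ fun j _ => hint j]
    simp only [integral_const, probReal_univ, one_smul, add_sub_cancel_left]
    refine Finset.sum_congr rfl fun j _ => ?_
    rw [integral_const_mul, integral_indicator_const _ (hB j)]
    simp
  calc _ = ∫ ω, ∏ i ∈ Finset.range ω.1, h (ω.2 i) ∂(poissonSampleMeasure r ρ) := by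
        congr 1
        funext ω
        rw [← Complex.exp_sum, ← Finset.sum_mul, ← Complex.ofReal_sum, Finset.sum_comm]
        congr 3
        refine Finset.sum_congr rfl fun j _ => ?_
        beta_reduce
        rw [← Finset.mul_sum, sampleCount, Finset.card_filter]
        push_cast
        rfl
    _ = _ := by
        rw [integral_prod_poissonSampleMeasure r ρ hm fun y =>
          (Complex.norm_exp_ofReal_mul_I _).le, hmean, Finset.mul_sum]
        congr 1
        refine Finset.sum_congr rfl fun j _ => ?_
        rw [NNReal.coe_mul, Complex.ofReal_mul, ENNReal.coe_toNNReal_eq_toReal, measureReal_def]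
        ring

lemma map_sampleCount (r : ℝ≥0) (ρ : Measure E) [IsProbabilityMeasure ρ] {B : Set E}
    (hB : MeasurableSet B) :
    (poissonSampleMeasure r ρ).map (sampleCount B) = poissonMeasure (r * (ρ B).toNNReal) := by
  have h1 := map_sampleCount_eq_pi r ρ (k := 1) (B := fun _ => B) (fun _ => hB)
    fun i j hij => (hij (Subsingleton.elim i j)).elim
  have h2 := congrArg (Measure.map (Function.eval (0 : Fin 1))) h1
  rw [(measurePreserving_eval (fun _ : Fin 1 => poissonMeasure (r * (ρ B).toNNReal)) 0).map_eq,
    Measure.map_map (measurable_pi_apply _)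
      (measurable_pi_lambda _ fun _ => measurable_sampleCount hB)] at h2
  exact h2

lemma iIndepFun_sampleCount (r : ℝ≥0) (ρ : Measure E) [IsProbabilityMeasure ρ] {k : ℕ}
    {B : Fin k → Set E} (hB : ∀ j, MeasurableSet (B j))
    (hdisj : Pairwise fun i j => Disjoint (B i) (B j)) :
    iIndepFun (fun j => sampleCount (B j)) (poissonSampleMeasure r ρ) := by
  rw [iIndepFun_iff_map_fun_eq_pi_map fun j => (measurable_sampleCount (hB j)).aemeasurable,
    map_sampleCount_eq_pi r ρ hB hdisj]
  simp_rw [map_sampleCount r ρ (hB _)]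

lemma toMeasure_sum_pointMass_range {B : Set E} (hB : MeasurableSet B) (ω : ℕ × (ℕ → E)) :
    ((∑ i ∈ Finset.range ω.1, pointMass (ω.2 i) : FiniteMeasure E) : Measure E) B
      = (sampleCount B ω : ℝ≥0∞) := by
  classical
  rw [FiniteMeasure.toMeasure_sum, Measure.finsetSum_apply]
  simp only [toMeasure_pointMass, Measure.dirac_apply' _ hB, sampleCount, Finset.card_filter]
  push_cast
  rfl

lemma measurableSet_range_fst_eq (S : Finset ℕ) :
    MeasurableSet {ω : ℕ × (ℕ → E) | Finset.range ω.1 = S} :=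
  measurable_fst (.of_discrete (s := {n : ℕ | Finset.range n = S}))

end PoissonProcess

/-- The uniform distribution on `[0, C]`. -/
noncomputable def uniformIcc (C : ℝ) : Measure (Set.Icc (0 : ℝ) C) :=
  (ENNReal.ofReal C)⁻¹ • (volume : Measure ℝ).comap Subtype.val

lemma isProbabilityMeasure_uniformIcc {C : ℝ} (hC : 0 < C) :
    IsProbabilityMeasure (uniformIcc C) := by
  constructor
  rw [uniformIcc, Measure.smul_apply, comap_subtype_coe_apply measurableSet_Icc,
    Subtype.coe_image_univ, Real.volume_Icc, sub_zero, smul_eq_mul]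
  exact ENNReal.inv_mul_cancel (by simpa using hC) ENNReal.ofReal_ne_top

lemma mul_uniformIcc_toNNReal {C : ℝ} (hC : 0 < C) (β : ℝ≥0) (B : Set (Set.Icc (0 : ℝ) C)) :
    β * C.toNNReal * (uniformIcc C B).toNNReal
      = β * (volume (Subtype.val '' B : Set ℝ)).toNNReal := by
  rw [uniformIcc, Measure.smul_apply,
    comap_subtype_coe_apply measurableSet_Icc, smul_eq_mul, ENNReal.toNNReal_mul,
    ENNReal.toNNReal_inv, mul_assoc]
  congr 1
  rw [← mul_assoc]
  have : C.toNNReal * (ENNReal.ofReal C).toNNReal⁻¹ = 1 :=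
    mul_inv_cancel₀ (by simpa using hC)
  rw [this, one_mul]

/-- The Poisson sample with uniform points is a homogeneous Poisson process on `[0, C]`. -/
theorem isHomogeneousPoissonProcess_poissonSample {C : ℝ} (hC : 0 < C) (β : ℝ≥0)
    [IsProbabilityMeasure (uniformIcc C)] :
    IsHomogeneousPoissonProcess (poissonSampleMeasure (β * C.toNNReal) (uniformIcc C)) C β
      (fun ω => ∑ i ∈ Finset.range ω.1, pointMass (ω.2 i)) where
  measurable := measurable_sum_pointMass measurableSet_range_fst_eq
    fun i => (measurable_pi_apply i).comp measurable_snd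
  law_count B hB := by
    simp_rw [toMeasure_sum_pointMass_range hB]
    rw [← mul_uniformIcc_toNNReal hC, ← map_sampleCount _ _ hB,
      Measure.map_map Measurable.of_discrete (measurable_sampleCount hB)]
    rfl
  indep_count k B hB hdisj := by
    simp_rw [toMeasure_sum_pointMass_range (hB _)]
    exact (iIndepFun_sampleCount _ _ hB hdisj).comp (fun _ (n : ℕ) => (n : ℝ≥0∞))
      fun _ => Measurable.of_discrete

/-! ### Convergence in distribution: change of the limit variable, discrete state spaces -/

lemma tendstoInDistribution_of_map_eq {Ω Ω₁ Ω₂ E : Type*} [MeasurableSpace Ω]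
    [MeasurableSpace Ω₁] [MeasurableSpace Ω₂] [MeasurableSpace E] [TopologicalSpace E]
    [OpensMeasurableSpace E] {P : Measure Ω} [IsProbabilityMeasure P] {P₁ : Measure Ω₁}
    [IsProbabilityMeasure P₁] {P₂ : Measure Ω₂} [IsProbabilityMeasure P₂] {X : ℕ → Ω → E}
    {Z₁ : Ω₁ → E} {Z₂ : Ω₂ → E} (h : TendstoInDistribution X atTop Z₁ (fun _ => P) P₁)
    (hZ : AEMeasurable Z₂ P₂) (heq : P₂.map Z₂ = P₁.map Z₁) :
    TendstoInDistribution X atTop Z₂ (fun _ => P) P₂ := by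
  refine ⟨h.forall_aemeasurable, hZ, ?_⟩
  have e : (⟨P₂.map Z₂, Measure.isProbabilityMeasure_map hZ⟩ : ProbabilityMeasure E)
      = ⟨P₁.map Z₁, Measure.isProbabilityMeasure_map h.aemeasurable_limit⟩ := Subtype.ext heq
  rw [e]
  exact h.tendsto

lemma tendsto_integral_of_tendstoInDistribution {Ω Ω₁ E : Type*} [MeasurableSpace Ω]
    [MeasurableSpace Ω₁] [MeasurableSpace E] [TopologicalSpace E] [OpensMeasurableSpace E]
    {P : Measure Ω} [IsProbabilityMeasure P] {P₁ : Measure Ω₁} [IsProbabilityMeasure P₁]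
    {X : ℕ → Ω → E} {Z : Ω₁ → E} (h : TendstoInDistribution X atTop Z (fun _ => P) P₁)
    (f : E →ᵇ ℝ) :
    Tendsto (fun n => ∫ ω, f (X n ω) ∂P) atTop (𝓝 (∫ ω, f (Z ω) ∂P₁)) := by
  have h1 := ProbabilityMeasure.tendsto_iff_forall_integral_tendsto.1 h.tendsto f
  have hf : ∀ μ : Measure E, AEStronglyMeasurable f μ := fun μ =>
    f.continuous.measurable.aestronglyMeasurable
  simp only [ProbabilityMeasure.coe_mk] at h1
  rw [integral_map h.aemeasurable_limit (hf _)] at h1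
  simpa only [integral_map (h.forall_aemeasurable _) (hf _)] using h1

lemma tendsto_measureReal_of_tendstoInDistribution {Ω Ω₁ E : Type*} [MeasurableSpace Ω]
    [MeasurableSpace Ω₁] [MeasurableSpace E] [TopologicalSpace E] [DiscreteTopology E]
    [BorelSpace E] {P : Measure Ω} [IsProbabilityMeasure P]
    {P₁ : Measure Ω₁} [IsProbabilityMeasure P₁] {X : ℕ → Ω → E} {Z : Ω₁ → E}
    (h : TendstoInDistribution X atTop Z (fun _ => P) P₁) (S : Set E) :
    Tendsto (fun n => P.real (X n ⁻¹' S)) atTop (𝓝 (P₁.real (Z ⁻¹' S))) := by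
  have hS : MeasurableSet S := (isOpen_discrete S).measurableSet
  have h1 := ProbabilityMeasure.tendsto_measure_of_null_frontier_of_tendsto' h.tendsto
    (E := S) (by simp)
  simp only [ProbabilityMeasure.coe_mk] at h1
  rw [Measure.map_apply_of_aemeasurable h.aemeasurable_limit hS] at h1
  simp only [Measure.map_apply_of_aemeasurable (h.forall_aemeasurable _) hS] at h1
  exact (ENNReal.tendsto_toReal (measure_ne_top _ _)).comp h1

lemma poissonMeasure_real_Ici (β : ℝ≥0) (k : ℕ) :
    (poissonMeasure β).real {n | k ≤ n}
      = ∑' j : ℕ, (β : ℝ) ^ (k + j) / ((k + j)! : ℝ) * Real.exp (-(β : ℝ)) := by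
  have h1 : (poissonMeasure β).real {n | k ≤ n}
      = ∫ n, {n | k ≤ n}.indicator (fun _ => (1 : ℝ)) n ∂(poissonMeasure β) := by
    rw [integral_indicator_const _ .of_discrete, smul_eq_mul, mul_one]
  rw [h1, integral_poissonMeasure]
  have hs : Summable fun n : ℕ => (Real.exp (-(β : ℝ)) * (β : ℝ) ^ n / (n ! : ℝ)) •
      {n | k ≤ n}.indicator (fun _ => (1 : ℝ)) n := by
    refine Summable.of_nonneg_of_le (fun n => ?_) (fun n => ?_)
      (hasSum_one_poissonMeasure β).summable
    · exact smul_nonneg (by positivity) (Set.indicator_nonneg (fun _ _ => zero_le_one) n)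
    · rw [smul_eq_mul]
      refine mul_le_of_le_one_right (by positivity) ?_
      exact Set.indicator_le_self' (fun _ _ => zero_le_one) n
  rw [← hs.sum_add_tsum_nat_add k, Finset.sum_eq_zero, zero_add]
  · refine tsum_congr fun j => ?_
    have hj : k + j ∈ {n | k ≤ n} := Nat.le_add_right k j
    rw [add_comm j k, Set.indicator_of_mem hj, smul_eq_mul]
    ring
  · intro n hn
    simp [Finset.mem_range.1 hn]

/-! ### Cells of equal length in `[0, C]` -/

lemma ceil_sub_one_eq_iff {x : ℝ} (hx : 0 ≤ x) (j : ℕ) :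
    ⌈x⌉₊ - 1 = j ↔ (x = 0 ∧ j = 0) ∨ ((j : ℝ) < x ∧ x ≤ j + 1) := by
  rcases hx.eq_or_lt with rfl | hx
  · have : ¬ (j : ℝ) < 0 := not_lt.2 (Nat.cast_nonneg j)
    simp [this, eq_comm]
  · have h1 : 0 < ⌈x⌉₊ := Nat.ceil_pos.2 hx
    have h2 : ⌈x⌉₊ - 1 = j ↔ ⌈x⌉₊ = j + 1 := by omega
    rw [h2, Nat.ceil_eq_iff (Nat.succ_ne_zero j)]
    simp [hx.ne']

/-- The index of the cell of `[0, C]` containing a given point, when `(0, C]` is divided into `M`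
left-open intervals of equal length. The point `0` is put into the first cell. -/
noncomputable def iccCell {C : ℝ} (hC : 0 < C) {M : ℕ} (hM : 0 < M) (y : Set.Icc (0 : ℝ) C) :
    Fin M :=
  ⟨⌈(y : ℝ) * (M / C)⌉₊ - 1, by
    have h : (y : ℝ) * (M / C) ≤ M := by
      rw [mul_div_assoc', div_le_iff₀ hC, mul_comm]
      exact mul_le_mul_of_nonneg_left y.2.2 (Nat.cast_nonneg _)
    have := Nat.ceil_le.2 h
    omega⟩

lemma iccCell_eq_iff {C : ℝ} (hC : 0 < C) {M : ℕ} (hM : 0 < M) (y : Set.Icc (0 : ℝ) C)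
    (j : Fin M) : iccCell hC hM y = j ↔ ((y : ℝ) = 0 ∧ (j : ℕ) = 0) ∨
      ((j : ℝ) * (C / M) < y ∧ (y : ℝ) ≤ (j + 1) * (C / M)) := by
  have hM' : (0 : ℝ) < M := Nat.cast_pos.2 hM
  have hq : 0 < (M : ℝ) / C := div_pos hM' hC
  have e : C / M = (M / C : ℝ)⁻¹ := (inv_div _ _).symm
  rw [Fin.ext_iff, iccCell, ceil_sub_one_eq_iff (mul_nonneg y.2.1 hq.le), e, ← div_eq_mul_inv,
    ← div_eq_mul_inv, div_lt_iff₀ hq, le_div_iff₀ hq]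
  simp [hq.ne']

lemma measurable_iccCell {C : ℝ} (hC : 0 < C) {M : ℕ} (hM : 0 < M) :
    Measurable (iccCell hC hM) := by
  refine measurable_to_countable' fun j => ?_
  have h : iccCell hC hM ⁻¹' {j} = {y : Set.Icc (0 : ℝ) C | ((y : ℝ) = 0 ∧ (j : ℕ) = 0) ∨
      ((j : ℝ) * (C / M) < y ∧ (y : ℝ) ≤ (j + 1) * (C / M))} := by
    ext y
    exact iccCell_eq_iff hC hM y j
  rw [h]
  have hv : Measurable fun y : Set.Icc (0 : ℝ) C => (y : ℝ) := measurable_subtype_coe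
  exact ((measurableSet_eq_fun hv measurable_const).inter (MeasurableSet.const _)).union
    ((measurableSet_lt measurable_const hv).inter (measurableSet_le hv measurable_const))

/-- The left end point of a cell. -/
noncomputable def iccCellPoint {C : ℝ} (hC : 0 < C) {M : ℕ} (j : Fin M) : Set.Icc (0 : ℝ) C :=
  ⟨j * (C / M), by positivity, by
    have hM : (0 : ℝ) < M := Nat.cast_pos.2 j.pos
    have h : (j : ℝ) ≤ M := by exact_mod_cast j.2.le
    calc (j : ℝ) * (C / M) ≤ M * (C / M) := mul_le_mul_of_nonneg_right h (by positivity)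
      _ = C := mul_div_cancel₀ C hM.ne'⟩

lemma dist_iccCellPoint_le {C : ℝ} (hC : 0 < C) {M : ℕ} (hM : 0 < M) (y : Set.Icc (0 : ℝ) C) :
    dist y (iccCellPoint hC (iccCell hC hM y)) ≤ C / M := by
  have hCM : 0 ≤ C / M := by positivity
  rw [Subtype.dist_eq, Real.dist_eq, iccCellPoint]
  rcases (iccCell_eq_iff hC hM y _).1 rfl with ⟨h0, h1⟩ | ⟨h0, h1⟩
  · simp [h0, h1, hCM]
  · rw [abs_of_pos (by linarith)]
    linarith

lemma volume_iccCell {C : ℝ} (hC : 0 < C) {M : ℕ} (hM : 0 < M) (j : Fin M) :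
    (volume (Subtype.val '' (iccCell hC hM ⁻¹' {j}) : Set ℝ)) = ENNReal.ofReal (C / M) := by
  have hCM : 0 ≤ C / M := by positivity
  have hlen : volume (Set.Ioc ((j : ℝ) * (C / M)) ((j + 1) * (C / M)))
      = ENNReal.ofReal (C / M) := by
    rw [Real.volume_Ioc]
    congr 1
    ring
  refine le_antisymm ?_ ?_
  · have hsub : (Subtype.val '' (iccCell hC hM ⁻¹' {j}) : Set ℝ)
        ⊆ {0} ∪ Set.Ioc ((j : ℝ) * (C / M)) ((j + 1) * (C / M)) := by
      rintro _ ⟨y, hy, rfl⟩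
      rcases (iccCell_eq_iff hC hM y j).1 hy with h | h
      · exact Or.inl h.1
      · exact Or.inr h
    refine (measure_mono hsub).trans ((measure_union_le _ _).trans ?_)
    rw [Real.volume_singleton, zero_add, hlen]
  · rw [← hlen]
    refine measure_mono fun x hx => ?_
    have h1 : (j : ℝ) + 1 ≤ M := by exact_mod_cast j.2
    have hx0 : 0 ≤ x := le_trans (by positivity) hx.1.le
    have hxC : x ≤ C := hx.2.trans <| by
      calc ((j : ℝ) + 1) * (C / M) ≤ M * (C / M) := mul_le_mul_of_nonneg_right h1 hCM
        _ = C := mul_div_cancel₀ C (Nat.cast_pos.2 hM).ne'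
    exact ⟨⟨x, hx0, hxC⟩, (iccCell_eq_iff hC hM _ j).2 (Or.inr hx), rfl⟩

/-- The number of lattice points `i / ν` in a cell. -/
lemma card_filter_iccCell {C : ℝ} (hC : 0 < C) {M : ℕ} (hM : 0 < M) (j : Fin M) {ν : ℕ}
    (hν : 0 < ν) :
    (((Finset.Icc 1 ⌊C * (ν : ℝ)⌋₊).filter fun i : ℕ =>
        iccCell hC hM (Set.projIcc 0 C hC.le ((i : ℝ) / ν)) = j).card : ℝ)
      = ⌊((j : ℝ) + 1) * (C / M) * ν⌋₊ - ⌊(j : ℝ) * (C / M) * ν⌋₊ := by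
  have hν' : (0 : ℝ) < ν := Nat.cast_pos.2 hν
  have hCM : 0 ≤ C / M := by positivity
  have h1 : (j : ℝ) + 1 ≤ M := by exact_mod_cast j.2
  have hle : ((j : ℝ) + 1) * (C / M) ≤ C := by
    calc ((j : ℝ) + 1) * (C / M) ≤ M * (C / M) := mul_le_mul_of_nonneg_right h1 hCM
      _ = C := mul_div_cancel₀ C (Nat.cast_pos.2 hM).ne'
  have hmono : ⌊(j : ℝ) * (C / M) * ν⌋₊ ≤ ⌊((j : ℝ) + 1) * (C / M) * ν⌋₊ :=
    Nat.floor_le_floor (by gcongr; linarith)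
  have hset : (Finset.Icc 1 ⌊C * (ν : ℝ)⌋₊).filter (fun i : ℕ =>
        iccCell hC hM (Set.projIcc 0 C hC.le ((i : ℝ) / ν)) = j)
      = Finset.Ioc ⌊(j : ℝ) * (C / M) * ν⌋₊ ⌊((j : ℝ) + 1) * (C / M) * ν⌋₊ := by
    ext i
    rw [Finset.mem_filter, Finset.mem_Icc, Finset.mem_Ioc, Nat.floor_lt (by positivity),
      Nat.le_floor_iff (by positivity), Nat.le_floor_iff (by positivity)]
    have key : ∀ (_ : 1 ≤ i) (_ : (i : ℝ) ≤ C * ν),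
        (iccCell hC hM (Set.projIcc 0 C hC.le ((i : ℝ) / ν)) = j ↔
          (j : ℝ) * (C / M) * ν < i ∧ (i : ℝ) ≤ (j + 1) * (C / M) * ν) := by
      intro hi1 hiC
      have hi0 : (0 : ℝ) < i := Nat.cast_pos.2 hi1
      have hmem : (i : ℝ) / ν ∈ Set.Icc 0 C := ⟨by positivity, (div_le_iff₀ hν').2 hiC⟩
      rw [Set.projIcc_of_mem hC.le hmem, iccCell_eq_iff]
      simp only
      rw [lt_div_iff₀ hν', div_le_iff₀ hν']
      simp [(div_pos hi0 hν').ne']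
    constructor
    · rintro ⟨⟨hi1, hiC⟩, h⟩
      exact (key hi1 hiC).1 h
    · rintro h
      have hi0 : (0 : ℝ) < i := lt_of_le_of_lt (by positivity) h.1
      have hi1 : 1 ≤ i := Nat.cast_pos.1 hi0
      have hiC : (i : ℝ) ≤ C * ν := h.2.trans (mul_le_mul_of_nonneg_right hle hν'.le)
      exact ⟨⟨hi1, hiC⟩, (key hi1 hiC).2 h⟩
  rw [hset, Nat.card_Ioc, Nat.cast_sub hmono]

lemma tendsto_card_filter_iccCell_div {C : ℝ} (hC : 0 < C) {M : ℕ} (hM : 0 < M) (j : Fin M) :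
    Tendsto (fun ν : ℕ => (((Finset.Icc 1 ⌊C * (ν : ℝ)⌋₊).filter fun i : ℕ =>
        iccCell hC hM (Set.projIcc 0 C hC.le ((i : ℝ) / ν)) = j).card : ℝ) / ν) atTop
      (𝓝 (C / M)) := by
  have hfl : ∀ a : ℝ, 0 ≤ a → Tendsto (fun ν : ℕ => (⌊a * (ν : ℝ)⌋₊ : ℝ) / ν) atTop (𝓝 a) :=
    fun a ha => (tendsto_nat_floor_mul_div_atTop ha).comp tendsto_natCast_atTop_atTop
  have h1 := (hfl (((j : ℝ) + 1) * (C / M)) (by positivity)).sub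
    (hfl ((j : ℝ) * (C / M)) (by positivity))
  rw [show ((j : ℝ) + 1) * (C / M) - j * (C / M) = C / M by ring] at h1
  refine h1.congr' ?_
  filter_upwards [eventually_gt_atTop 0] with ν hν
  rw [card_filter_iccCell hC hM j hν, sub_div]

/-! ### Exceedance counts and the exceedance process -/

lemma measurableSet_filter_exceedance_eq {Ω : Type*} [MeasurableSpace Ω] {X : ℤ → Ω → ℝ}
    (hX : ∀ i, Measurable (X i)) (n : ℕ) (t : ℝ) [∀ ω, DecidablePred fun i : ℕ => t < X i ω]
    (S : Finset ℕ) :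
    MeasurableSet {ω | (Finset.Icc 1 n).filter (fun i : ℕ => t < X i ω) = S} := by
  have h : {ω | (Finset.Icc 1 n).filter (fun i : ℕ => t < X i ω) = S}
      = ⋂ i : ℕ, {ω | (i ∈ Finset.Icc 1 n ∧ t < X i ω) ↔ i ∈ S} := by
    ext ω
    simp only [Set.mem_iInter, Set.mem_ofPred_eq, Finset.ext_iff, Finset.mem_filter]
  rw [h]
  refine MeasurableSet.iInter fun i => ?_
  have hm : MeasurableSet {ω | t < X i ω} := measurableSet_lt measurable_const (hX i)
  exact ((MeasurableSet.const (i ∈ Finset.Icc 1 n)).inter hm).iff (MeasurableSet.const (i ∈ S))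

open Classical in
lemma exceedanceProcess_eq_sum {Ω : Type*} (X : ℤ → Ω → ℝ) {C : ℝ} (hC : 0 < C) (ν : ℕ) (t : ℝ)
    (ω : Ω) : exceedanceProcess X C ν t ω
      = ∑ i ∈ (Finset.Icc 1 ⌊C * (ν : ℝ)⌋₊).filter (fun i : ℕ => t < X (i : ℤ) ω),
        pointMass (Set.projIcc 0 C hC.le ((i : ℝ) / ν)) := by
  refine Finset.sum_congr rfl fun i hi => ?_
  obtain ⟨hi1, hi2⟩ := Finset.mem_Icc.1 (Finset.mem_filter.1 hi).1
  have hν : 0 < (ν : ℝ) := by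
    rcases Nat.eq_zero_or_pos ν with rfl | h
    · -- for `ν = 0` there are no indices
      simp only [Nat.cast_zero, mul_zero, Nat.floor_zero] at hi2
      omega
    · exact Nat.cast_pos.2 h
  have hmem : (i : ℝ) / ν ∈ Set.Icc 0 C :=
    ⟨by positivity, (div_le_iff₀ hν).2 ((Nat.le_floor_iff (by positivity)).1 hi2)⟩
  rw [dif_pos hmem, Set.projIcc_of_mem hC.le hmem]

/-- The number of exceedances of the `i + 1`-st level is the number of observations in the first
`i + 1` bands. -/
lemma exceedanceCount_eq_sum_bandCount {Ω : Type*} (X : ℤ → Ω → ℝ) (ν : ℕ) {t : ℕ → ℝ}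
    (ht : ∀ i, 1 ≤ i → t (i + 1) < t i) (ω : Ω) (i : ℕ) :
    exceedanceCount X ν (t (i + 1)) ω = ∑ j ∈ Finset.range (i + 1), bandCount X ν t (j + 1) ω := by
  classical
  induction i with
  | zero => simp [exceedanceCount, bandCount]
  | succ i ih =>
    rw [Finset.sum_range_succ, ← ih]
    simp only [exceedanceCount, bandCount, Finset.card_filter]
    rw [← Finset.sum_add_distrib]
    refine Finset.sum_congr rfl fun j _ => ?_
    have h1 := ht (i + 1) (by omega)
    have h2 : ¬ i + 1 + 1 = 1 := by omega
    simp only [h2, false_or, Nat.add_sub_cancel]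
    by_cases h3 : t (i + 1) < X j ω
    · simp [h3, h1.trans h3]
    · simp [h3, not_lt.1 h3]

lemma sum_Iic_fin_eq_sum_range {M : Type*} [AddCommMonoid M] {k : ℕ} (f : ℕ → M) (i : Fin k) :
    ∑ j ∈ Finset.Iic i, f j = ∑ j ∈ Finset.range ((i : ℕ) + 1), f j := by
  rw [Nat.range_succ_eq_Iic, ← Fin.map_valEmbedding_Iic, Finset.sum_map]
  rfl

section MovingAverage

variable {Ω : Type*} [MeasurableSpace Ω] {P : Measure Ω} [IsProbabilityMeasure P]
  {ε : ℤ → Ω → ℝ} {θ : ℤ →₀ ℝ} {β : ℝ≥0}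

/-- Cell counts of the exceedance process converge to those of the Poisson sample. -/
theorem tendstoInDistribution_cellCount (hmeas : ∀ i, Measurable (ε i)) (hindep : iIndepFun ε P)
    (hident : ∀ i, IdentDistrib (ε i) (ε 0) P P)
    (htail : ∀ x : ℝ, 0 < P {ω | x < movingAverage θ ε 0 ω})
    (hclust : NoClustering P (movingAverage θ ε)) {t : ℕ → ℝ}
    (ht : IsCalibrated P (movingAverage θ ε) β t) {C : ℝ} (hC : 0 < C)
    [IsProbabilityMeasure (uniformIcc C)] {M : ℕ} (hM : 0 < M)
    [∀ ν ω, DecidablePred fun i : ℕ => t ν < movingAverage θ ε i ω] :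
    TendstoInDistribution (fun ν : ℕ => cellCount (iccCell hC hM)
        (fun ω => (Finset.Icc 1 ⌊C * (ν : ℝ)⌋₊).filter fun i : ℕ =>
          t ν < movingAverage θ ε i ω)
        (fun i _ => Set.projIcc 0 C hC.le ((i : ℝ) / ν))) atTop
      (cellCount (iccCell hC hM) (fun ω => Finset.range ω.1) (fun i ω => ω.2 i)) (fun _ => P)
      (poissonSampleMeasure (β * C.toNNReal) (uniformIcc C)) := by
  classical
  have hcell : ∀ j, MeasurableSet (iccCell hC hM ⁻¹' {j}) := fun j =>
    measurable_iccCell hC hM (measurableSet_singleton j)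
  have hdisj : Pairwise fun i j => Disjoint (iccCell hC hM ⁻¹' {i}) (iccCell hC hM ⁻¹' {j}) :=
    fun i j hij => Disjoint.preimage _ (by simpa using hij)
  have hlimit : cellCount (iccCell hC hM) (fun ω => Finset.range ω.1) (fun i ω => ω.2 i)
      = fun ω j => sampleCount (iccCell hC hM ⁻¹' {j}) ω := by
    funext ω j
    rw [cellCount, sampleCount]
    congr 1
    ext i
    simp
  -- an exceedance at time `i` is recorded as a visit of the type given by the cell of `i / ν`
  let B : ℕ → ℕ → Fin M → Set ℝ := fun ν i j =>
    if iccCell hC hM (Set.projIcc 0 C hC.le ((i : ℝ) / ν)) = j then Set.Ioi (t ν) else ∅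
  have hBsum : ∀ (ν : ℕ) j, ∑ i ∈ Finset.Icc 1 ⌊C * (ν : ℝ)⌋₊,
        P.real {ω | movingAverage θ ε 0 ω ∈ B ν i j}
      = ((Finset.Icc 1 ⌊C * (ν : ℝ)⌋₊).filter fun i : ℕ =>
          iccCell hC hM (Set.projIcc 0 C hC.le ((i : ℝ) / ν)) = j).card *
        P.real {ω | t ν < movingAverage θ ε 0 ω} := fun ν j => by
    rw [Finset.card_filter, Nat.cast_sum, Finset.sum_mul]
    refine Finset.sum_congr rfl fun i _ => ?_
    by_cases h : iccCell hC hM (Set.projIcc 0 C hC.le ((i : ℝ) / ν)) = j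
    · simp [B, h]
    · simp [B, h]
  have hmul := ht.tendsto_mul
  have hbdd : ∀ᶠ ν : ℕ in atTop, (⌊C * (ν : ℝ)⌋₊ : ℝ) *
      P.real {ω | t ν < movingAverage θ ε 0 ω} ≤ C * (β + 1) := by
    filter_upwards [hmul.eventually_le_const (lt_add_one (β : ℝ))] with ν hν
    calc _ ≤ C * ν * P.real {ω | t ν < movingAverage θ ε 0 ω} :=
          mul_le_mul_of_nonneg_right (Nat.floor_le (by positivity)) measureReal_nonneg
      _ ≤ C * (β + 1) := by
          rw [mul_assoc]
          exact mul_le_mul_of_nonneg_left hν hC.le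
  have key := tendstoInDistribution_visitCount hmeas hindep hident θ htail hclust
    (fun j => β * C.toNNReal * (uniformIcc C (iccCell hC hM ⁻¹' {j})).toNNReal)
    (fun ν : ℕ => ⌊C * (ν : ℝ)⌋₊) t B
    (fun ν i j => by simp only [B]; split_ifs <;> measurability)
    (fun ν i j => by simp only [B]; split_ifs <;> simp)
    (fun ν i j j' hjj' => by
      simp only [B]
      split_ifs with h1 h2
      · exact absurd (h1.symm.trans h2) hjj'
      all_goals simp)
    (ht.tendsto_atTop htail) ht.tendsto_zero _ hbdd
    (fun j => by
      simp_rw [hBsum]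
      rw [mul_uniformIcc_toNNReal hC, volume_iccCell, NNReal.coe_mul,
        ENNReal.coe_toNNReal_eq_toReal, ENNReal.toReal_ofReal (by positivity), mul_comm (β : ℝ)]
      refine ((tendsto_card_filter_iccCell_div hC hM j).mul hmul).congr' ?_
      filter_upwards [eventually_gt_atTop 0] with ν hν
      have : (ν : ℝ) ≠ 0 := by positivity
      field_simp)
  have key' := tendstoInDistribution_of_map_eq key
    (Z₂ := cellCount (iccCell hC hM) (fun ω => Finset.range ω.1) (fun i ω => ω.2 i))
    (P₂ := poissonSampleMeasure (β * C.toNNReal) (uniformIcc C))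
    (by
      rw [hlimit]
      exact (measurable_pi_lambda _ fun j => measurable_sampleCount (hcell j)).aemeasurable)
    (by rw [hlimit, map_sampleCount_eq_pi _ _ hcell hdisj, Measure.map_id])
  convert! key' using 1
  funext ν ω j
  rw [cellCount, Finset.filter_filter]
  congr 1
  ext i
  simp only [Finset.mem_filter, B]
  split_ifs with h <;> simp [h]

/-- The exceedance process converges weakly to a homogeneous Poisson process. -/
theorem convergesWeakly_exceedanceProcess (hmeas : ∀ i, Measurable (ε i))
    (hindep : iIndepFun ε P) (hident : ∀ i, IdentDistrib (ε i) (ε 0) P P)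
    (htail : ∀ x : ℝ, 0 < P {ω | x < movingAverage θ ε 0 ω})
    (hclust : NoClustering P (movingAverage θ ε)) {t : ℕ → ℝ}
    (ht : IsCalibrated P (movingAverage θ ε) β t) {C : ℝ} (hC : 0 < C)
    [IsProbabilityMeasure (uniformIcc C)] :
    ConvergesWeakly P (fun ν => exceedanceProcess (movingAverage θ ε) C ν (t ν))
      (poissonSampleMeasure (β * C.toNNReal) (uniformIcc C))
      (fun ω => ∑ i ∈ Finset.range ω.1, pointMass (ω.2 i)) := by
  classical
  have hX := measurable_movingAverage (θ := θ) hmeas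
  have key := convergesWeakly_of_cellCount (P := P)
    (P' := poissonSampleMeasure (β * C.toNNReal) (uniformIcc C))
    (T := fun (ν : ℕ) ω => (Finset.Icc 1 ⌊C * (ν : ℝ)⌋₊).filter fun i : ℕ =>
      t ν < movingAverage θ ε i ω)
    (fun ν => measurableSet_filter_exceedance_eq hX _ _)
    (x := fun (ν i : ℕ) _ => Set.projIcc 0 C hC.le ((i : ℝ) / ν)) (fun _ _ => measurable_const)
    (T' := fun ω => Finset.range ω.1) measurableSet_range_fst_eq
    (x' := fun i ω => ω.2 i) (fun i => (measurable_pi_apply i).comp measurable_snd)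
    (fun η hη => by
      obtain ⟨M, hMη⟩ := exists_nat_gt (C / η)
      have hM' : (0 : ℝ) < M := (div_pos hC hη).trans hMη
      have hM : 0 < M := Nat.cast_pos.1 hM'
      refine ⟨M, iccCell hC hM, iccCellPoint hC, measurable_iccCell hC hM, fun y => ?_, ?_⟩
      · refine (dist_iccCellPoint_le hC hM y).trans_lt ?_
        rw [div_lt_iff₀ hM', mul_comm]
        exact (div_lt_iff₀ hη).1 hMη
      · exact tendsto_integral_of_tendstoInDistribution
          (tendstoInDistribution_cellCount hmeas hindep hident htail hclust ht hC hM))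
  convert! key using 1
  funext ν ω
  rw [exceedanceProcess_eq_sum _ hC]

theorem tendstoInDistribution_exceedanceCount (hmeas : ∀ i, Measurable (ε i))
    (hindep : iIndepFun ε P) (hident : ∀ i, IdentDistrib (ε i) (ε 0) P P)
    (htail : ∀ x : ℝ, 0 < P {ω | x < movingAverage θ ε 0 ω})
    (hclust : NoClustering P (movingAverage θ ε)) {t : ℕ → ℝ}
    (ht : IsCalibrated P (movingAverage θ ε) β t) :
    TendstoInDistribution (fun ν ω => exceedanceCount (movingAverage θ ε) ν (t ν) ω) atTop
      (id : ℕ → ℕ) (fun _ => P) (poissonMeasure β) := by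
  classical
  have key := tendstoInDistribution_visitCount hmeas hindep hident θ htail hclust
    (fun _ : Fin 1 => β) (fun ν => ν) t (fun ν _ _ => Set.Ioi (t ν))
    (fun _ _ _ => measurableSet_Ioi) (fun _ _ _ => subset_rfl)
    (fun _ _ i j hij => absurd (Subsingleton.elim i j) hij)
    (ht.tendsto_atTop htail) ht.tendsto_zero (β + 1)
    (ht.tendsto_mul.eventually_le_const (lt_add_one (β : ℝ)))
    (fun j => by simpa using ht.tendsto_mul)
  have key' := key.continuous_comp (continuous_apply (0 : Fin 1))
  have hid : (poissonMeasure β).map id = (Measure.pi fun _ : Fin 1 => poissonMeasure β).map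
      ((fun p : Fin 1 → ℕ => p 0) ∘ id) := by
    rw [Measure.map_id]
    exact (measurePreserving_eval (fun _ : Fin 1 => poissonMeasure β) 0).map_eq.symm
  have key'' := tendstoInDistribution_of_map_eq key' aemeasurable_id hid
  convert! key'' using 1

theorem tendstoInDistribution_bandCount (hmeas : ∀ i, Measurable (ε i))
    (hindep : iIndepFun ε P) (hident : ∀ i, IdentDistrib (ε i) (ε 0) P P)
    (htail : ∀ x : ℝ, 0 < P {ω | x < movingAverage θ ε 0 ω})
    (hclust : NoClustering P (movingAverage θ ε)) {t : ℕ → ℕ → ℝ}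
    (hanti : ∀ ν i : ℕ, 1 ≤ i → t ν (i + 1) < t ν i)
    (ht : ∀ i : ℕ, 1 ≤ i → IsCalibrated P (movingAverage θ ε) (i * β) (fun ν => t ν i))
    {k : ℕ} (hk : 1 ≤ k) :
    TendstoInDistribution
      (fun ν ω (i : Fin k) => bandCount (movingAverage θ ε) ν (t ν) (i + 1) ω) atTop
      (id : (Fin k → ℕ) → (Fin k → ℕ)) (fun _ => P)
      (Measure.pi (fun _ : Fin k => poissonMeasure β)) := by
  classical
  have hX := measurable_movingAverage (θ := θ) hmeas
  have hmono : ∀ ν i j, 1 ≤ i → i ≤ j → t ν j ≤ t ν i := fun ν i j hi hij => by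
    induction j, hij using Nat.le_induction with
    | base => exact le_rfl
    | succ j hj ih => exact (hanti ν j (hi.trans hj)).le.trans ih
  -- the bands, all of which lie above the lowest level `t ν k`
  let B : ℕ → ℕ → Fin k → Set ℝ := fun ν _ j =>
    {x | t ν (j + 1) < x ∧ ((j : ℕ) = 0 ∨ x ≤ t ν j)}
  have hB : ∀ ν i j, MeasurableSet (B ν i j) := fun ν i j =>
    measurableSet_Ioi.inter ((MeasurableSet.const _).union measurableSet_Iic)
  have hprob : ∀ ν i (j : Fin k), P.real {ω | movingAverage θ ε 0 ω ∈ B ν i j}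
      = P.real {ω | t ν (j + 1) < movingAverage θ ε 0 ω}
        - if (j : ℕ) = 0 then 0 else P.real {ω | t ν j < movingAverage θ ε 0 ω} := by
    intro ν i j
    split_ifs with hj
    · simp [B, hj]
    · rw [← measureReal_sdiff]
      · congr 1
        ext ω
        simp [B, hj]
      · intro ω hω
        exact (hanti ν j (by omega)).trans hω
      · exact measurableSet_lt measurable_const (hX 0)
  have key := tendstoInDistribution_visitCount hmeas hindep hident θ htail hclust
    (fun _ : Fin k => β) (fun ν => ν) (fun ν => t ν k) B hB
    (fun ν i j x hx => (hmono ν (j + 1) k (by omega) j.2).trans_lt hx.1)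
    (fun ν i j j' hjj' => by
      have haux : ∀ a b : Fin k, a < b → Disjoint (B ν i a) (B ν i b) := fun a b hab => by
        have hab' : (a : ℕ) < b := hab
        refine Set.disjoint_left.2 fun x hx hx' => ?_
        have h1 : x ≤ t ν b := hx'.2.resolve_left (by omega)
        exact absurd (hx.1.trans_le h1) (hmono ν (a + 1) b (by omega) hab').not_gt
      rcases lt_or_gt_of_ne hjj' with h | h
      · exact haux _ _ h
      · exact (haux _ _ h).symm)
    ((ht k hk).tendsto_atTop htail) (ht k hk).tendsto_zero (k * β + 1)
    ((ht k hk).tendsto_mul.eventually_le_const (lt_add_one _))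
    (fun j => by
      simp only [hprob, Finset.sum_const, Nat.card_Icc, Nat.add_sub_cancel, nsmul_eq_mul]
      have h1 := (ht (j + 1) (by omega)).tendsto_mul
      by_cases hj : (j : ℕ) = 0
      · simpa [hj] using h1
      · have h2 := h1.sub (ht j (by omega)).tendsto_mul
        have e : ((j + 1 : ℕ) : ℝ) * (β : ℝ) - (j : ℕ) * β = β := by push_cast; ring
        rw [e] at h2
        simpa only [hj, if_false, mul_sub] using h2)
  convert! key using 1
  funext ν ω j
  rw [bandCount]
  congr 1
  ext i
  simp [B]

end MovingAverage

theorem theorem3p2 {Ω : Type*} [MeasurableSpace Ω] (P : Measure Ω) [IsProbabilityMeasure P]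
    (ε : ℤ → Ω → ℝ) (hmeas : ∀ i, Measurable (ε i)) (hindep : iIndepFun ε P)
    (hident : ∀ i, IdentDistrib (ε i) (ε 0) P P)
    (θ : ℤ →₀ ℝ) (hθ : θ ≠ 0)
    (htail : ∀ x : ℝ, 0 < P {ω | x < movingAverage θ ε 0 ω})
    (hclust : NoClustering P (movingAverage θ ε))
    (β : ℝ≥0) (hβ : 0 < β) :
    (∀ t : ℕ → ℝ, IsCalibrated P (movingAverage θ ε) β t →
      (∀ C : ℝ, 0 < C →
        ∃ (Ω' : Type) (_ : MeasurableSpace Ω') (P' : Measure Ω') (_ : IsProbabilityMeasure P')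
          (η : Ω' → FiniteMeasure (Set.Icc (0 : ℝ) C)),
          IsHomogeneousPoissonProcess P' C β η ∧
          ConvergesWeakly P (fun ν => exceedanceProcess (movingAverage θ ε) C ν (t ν)) P' η) ∧
      TendstoInDistribution (fun ν ω => exceedanceCount (movingAverage θ ε) ν (t ν) ω) atTop
        (id : ℕ → ℕ) (fun _ => P) (poissonMeasure β) ∧
      (∀ k : ℕ, 1 ≤ k →
        Tendsto (fun ν : ℕ => P.real {ω | k ≤ exceedanceCount (movingAverage θ ε) ν (t ν) ω}) atTop
          (𝓝 (∑' j : ℕ, (β : ℝ) ^ (k + j) / ((k + j)! : ℝ) * Real.exp (-(β : ℝ)))))) ∧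
    (∀ t : ℕ → ℕ → ℝ, (∀ ν i : ℕ, 1 ≤ i → t ν (i + 1) < t ν i) →
      (∀ i : ℕ, 1 ≤ i → IsCalibrated P (movingAverage θ ε) (i * β) (fun ν => t ν i)) →
      ∀ k : ℕ, 1 ≤ k →
        TendstoInDistribution
          (fun ν ω (i : Fin k) => bandCount (movingAverage θ ε) ν (t ν) (i + 1) ω) atTop
          (id : (Fin k → ℕ) → (Fin k → ℕ)) (fun _ => P)
          (Measure.pi (fun _ : Fin k => poissonMeasure β)) ∧
        Tendsto
          (fun ν : ℕ => P.real {ω | ∀ i : ℕ, 1 ≤ i → i ≤ k →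
            i ≤ exceedanceCount (movingAverage θ ε) ν (t ν i) ω}) atTop
          (𝓝 ((Measure.pi (fun _ : Fin k => poissonMeasure β)).real
            {q | ∀ i : Fin k, (i : ℕ) + 1 ≤ ∑ j ∈ Finset.Iic i, q j}))) := by
  refine ⟨fun t ht => ⟨fun C hC => ?_, ?_, fun k _ => ?_⟩, fun t hanti ht k hk => ⟨?_, ?_⟩⟩
  · have := isProbabilityMeasure_uniformIcc hC
    exact ⟨_, _, poissonSampleMeasure (β * C.toNNReal) (uniformIcc C), inferInstance, _,
      isHomogeneousPoissonProcess_poissonSample hC β,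
      convergesWeakly_exceedanceProcess hmeas hindep hident htail hclust ht hC⟩
  · exact tendstoInDistribution_exceedanceCount hmeas hindep hident htail hclust ht
  · rw [← poissonMeasure_real_Ici]
    exact tendsto_measureReal_of_tendstoInDistribution
      (tendstoInDistribution_exceedanceCount hmeas hindep hident htail hclust ht) {n | k ≤ n}
  · exact tendstoInDistribution_bandCount hmeas hindep hident htail hclust hanti ht hk
  · have key := tendsto_measureReal_of_tendstoInDistribution
      (tendstoInDistribution_bandCount hmeas hindep hident htail hclust hanti ht hk)
      {q | ∀ i : Fin k, (i : ℕ) + 1 ≤ ∑ j ∈ Finset.Iic i, q j}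
    refine key.congr fun ν => congrArg P.real ?_
    ext ω
    simp only [Set.mem_preimage, Set.mem_ofPred_eq]
    have hsum : ∀ i : Fin k, ∑ j ∈ Finset.Iic i, bandCount (movingAverage θ ε) ν (t ν) (j + 1) ω
        = exceedanceCount (movingAverage θ ε) ν (t ν (i + 1)) ω := fun i => by
      rw [exceedanceCount_eq_sum_bandCount _ _ (hanti ν),
        ← sum_Iic_fin_eq_sum_range fun j => bandCount (movingAverage θ ε) ν (t ν) (j + 1) ω]
    simp only [hsum]
    constructor
    · intro h i hi hik
      have h1 := h ⟨i - 1, by omega⟩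
      simpa only [Nat.sub_add_cancel hi] using h1
    · intro h i
      exact h (i + 1) (by omega) i.2
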